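/- **Setting.** Let $P\ge 1$, $\kappa\ge 1$, $\mu=\kappa-1$, $d=2^{\kappa}P$. A walker has computational basis $|x,c_0,\dots,c_{\kappa-1}\rangle$ with $x\in\mathbb Z/P$ and $c_i\in\{0,1\}$; $c_{\kappa-1}$ is the active coin, $c_0,\dots,c_{\mu-1}$ are the memory coins. Let $W=MSC$, where $C$ applies a coin operator to the active coin, $S|x,c\rangle=|x+(-1)^{c_{\kappa-1}},c\rangle$ and $M|x,c_0,\dots,c_{\kappa-1}\rangle=|x,c_{\kappa-1},c_0,\dots,c_{\kappa-2}\rangle$. The honest state is $|w_0\rangle=W^T(I\otimes f)|0,0,\dots,0\rangle$, with $f$ acting on the active coin. The parameters range over one of two families, for a finite set $\mathcal T$ of candidate times: (a) $T\in\mathcal T$, Hadamard coin, $f=I$; (b) $T\in\mathcal T$, coin $\begin{pmatrix}e^{i\phi}\cos\theta&e^{i\phi}\sin\theta\\-e^{-i\phi}\sin\theta&e^{-i\phi}\cos\theta\end{pmatrix}$ with $\theta,\phi\in\{g\pi/R:g=0,\dots,R\}$ for a fixed integer $R\ge 1$, and $f\in\left\{I,\tfrac1{\sqrt2}\begin{pmatrix}1&1\\1&-1\end{pmatrix},\tfrac1{\sqrt2}\begin{pmatrix}1&1\\i&-i\end{pmatrix}\right\}$.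 Let $G'$ (resp. $G''$) be the minimum over the family of the largest outcome probability when position and memory coins (resp. position only) of $|w_0\rangle$ are measured. **Protocol.** A source prepares an arbitrary unit vector $|\psi\rangle\in\mathcal H_W^{\otimes N}\otimes\mathcal H_E$, with $\mathcal H_E$ any complex Hilbert space, held by the adversary. Alice picks a uniformly random subset $t$ of $m$ of the $N$ walkers, $1\le m\le N/2$, measures each of them with $\{|w_0\rangle\langle w_0|,\,I-|w_0\rangle\langle w_0|\}$, obtaining $q\in\{0,1\}^m$ of relative Hamming weight $w(q)$, and measures position and memory coins (using memory case) or position only (not using memory case) of each of the other $n=N-m$ walkers, obtaining the raw string. The walk parameters in use attain the minimum that defines $G'$, resp. $G''$. She applies a function drawn from a two-universal family to the raw string, which gives the final string. **Theorem.** Let $\varepsilon>0$ and $$\delta=\sqrt{\frac{(N+2)\ln(2/\varepsilon^2)}{mN}},\qquad \eta_q=(N-m)(1-w(q)-\delta),\qquad \gamma'=-\log_2G'\ \text{ (using memory), resp. }\ \gamma'=-\log_2G''\ \text{ (not using memory)},$$ $$\ell'=\eta_q\gamma'-n\,\frac{\bar H_{d}(w(q)+\delta)}{\log_{d}(2)}-2\log_2\frac1\varepsilon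 ,$$ where $\bar H_d(x)$ is $0$ for $x<0$, is $x\log_d(d-1)-x\log_dx-(1-x)\log_d(1-x)$ for $0\le x\le 1-1/d$, and is $1$ for $x>1-1/d$. In both cases and for both families, the following holds except with probability at most $\varepsilon^{1/3}$ over the choice of $t$ and the outcome $q$: if the final string has $\lfloor\ell'\rfloor$ bits (no bits if $\ell'<0$), then it is $(5\varepsilon+2\varepsilon^{1/3})$-close to ideal, that is, the state $\sigma_{YE}$ of the final string and the adversary's system conditioned on $t$ and $q$, with the adversary also knowing the hash function, satisfies $\big\|\sigma_{YE}-\tfrac{I_Y}{2^{\lfloor\ell'\rfloor}}\otimes\sigma_E\big\|_1\le 5\varepsilon+2\varepsilon^{1/3}$. -/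

import Mathlib

namespace QWRNG

noncomputable section

/-! ### The walker -/

/-- Computational basis labels `(x, c_0, …, c_{κ-1})` of one walker with `κ = μ + 1` coins: the
position `x` modulo `P`, the memory coins `c_0, …, c_{μ-1}` and the active coin `c_μ`. -/
abbrev Walker (P μ : ℕ) : Type := ZMod P × (Fin (μ + 1) → Fin 2)

/-- Operators on the space of one walker, as matrices in the computational basis. -/
abbrev WalkerOp (P μ : ℕ) : Type := Matrix (Walker P μ) (Walker P μ) ℂ

/-- Operators on one coin. -/
abbrev CoinOp : Type := Matrix (Fin 2) (Fin 2) ℂ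

variable {P μ : ℕ} [NeZero P]

/-- `I_P ⊗ I_M ⊗ U`: the operator `U` on the active coin. -/
def onActiveCoin (P μ : ℕ) (U : CoinOp) : WalkerOp P μ :=
  Matrix.of fun s' s =>
    if s'.1 = s.1 ∧ Fin.init s'.2 = Fin.init s.2 then
      U (s'.2 (Fin.last μ)) (s.2 (Fin.last μ))
    else 0

/-- The linear operator sending the basis vector `|s⟩` to `|g s⟩`. -/
def basisMap (g : Walker P μ → Walker P μ) : WalkerOp P μ :=
  Matrix.of fun s' s => if s' = g s then 1 else 0

/-- The shift `|x, c⟩ ↦ |x + (-1)^{c_{κ-1}}, c⟩`. -/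
def shiftOp (P μ : ℕ) [NeZero P] : WalkerOp P μ :=
  basisMap fun s => (s.1 + (-1) ^ (s.2 (Fin.last μ) : ℕ), s.2)

/-- The memory operator `|x, c_0, …, c_{κ-1}⟩ ↦ |x, c_{κ-1}, c_0, …, c_{κ-2}⟩`. -/
def memoryOp (P μ : ℕ) [NeZero P] : WalkerOp P μ :=
  basisMap fun s => (s.1, Fin.cons (s.2 (Fin.last μ)) (Fin.init s.2))

/-- The walk operator `W = M · S · C`. -/
def walkOp (P μ : ℕ) [NeZero P] (coin : CoinOp) : WalkerOp P μ :=
  memoryOp P μ * shiftOp P μ * onActiveCoin P μ coin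

/-- The parameters of a walk: the number of steps, the coin operator, and the operator applied
once to the active coin before the evolution. -/
structure WalkSetting where
  steps : ℕ
  coin : CoinOp
  flip : CoinOp

/-- The honest state `|w_0⟩ = W^T (I ⊗ f) |0, 0, …, 0⟩`. -/
def honestState (P μ : ℕ) [NeZero P] (w : WalkSetting) : Walker P μ → ℂ :=
  Matrix.mulVec (walkOp P μ w.coin ^ w.steps)
    (Matrix.mulVec (onActiveCoin P μ w.flip) (Pi.single (0, 0) 1))

/-- The Hadamard coin. -/
def hadamardCoin : CoinOp := ((Real.sqrt 2 : ℂ)⁻¹) • !![1, 1; 1, -1]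

/-- The generalized coin with angle `θ` and phase `φ`. -/
def generalCoin (θ φ : ℝ) : CoinOp :=
  !![Complex.exp (Complex.I * φ) * Real.cos θ, Complex.exp (Complex.I * φ) * Real.sin θ;
    -Complex.exp (-(Complex.I * φ)) * Real.sin θ, Complex.exp (-(Complex.I * φ)) * Real.cos θ]

/-- The set `F = {I, X, Y}` of flip-coin operators. -/
def flipCoins : Set CoinOp :=
  {1, ((Real.sqrt 2 : ℂ)⁻¹) • !![1, 1; 1, -1],
    ((Real.sqrt 2 : ℂ)⁻¹) • !![1, 1; Complex.I, -Complex.I]}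

/-- The two kinds of walk: Hadamard coin without flip, or generalized and flip coins with
angle and phase on the grid `{g π / R : g = 0, …, R}`. -/
inductive CoinFamily where
  | hadamard : CoinFamily
  | general (R : ℕ+) : CoinFamily

/-- The settings over which the walk is optimized, for the candidate times `times`. -/
def settings (times : Finset ℕ) : CoinFamily → Set WalkSetting
  | .hadamard => {w | w.steps ∈ times ∧ w.coin = hadamardCoin ∧ w.flip = 1}
  | .general R => {w | w.steps ∈ times ∧ w.flip ∈ flipCoins ∧
      ∃ g g' : ℕ, g ≤ R ∧ g' ≤ R ∧
        w.coin = generalCoin (g * Real.pi / (R : ℕ)) (g' * Real.pi / (R : ℕ))}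

/-! ### Extraction measurements and maximum probabilities -/

/-- The position and the memory coins of a basis label. -/
def positionAndMemory (s : Walker P μ) : ZMod P × (Fin μ → Fin 2) := (s.1, Fin.init s.2)

/-- The position of a basis label. -/
def positionOnly (s : Walker P μ) : ZMod P := s.1

variable {O : Type} [Fintype O] [DecidableEq O]

/-- The element with outcome `o` of the projective measurement that reads off `out s` from the
basis label `s`. For `positionAndMemory` this is `[x] ⊗ [c_μ] ⊗ I`, for `positionOnly` it is
`[x] ⊗ I ⊗ I`. -/
def extractOp (out : Walker P μ → O) (o : O) : WalkerOp P μ :=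
  Matrix.diagonal fun s => if out s = o then 1 else 0

/-- The probability of outcome `o` when the honest state is measured. -/
def honestProb (out : Walker P μ → O) (w : WalkSetting) (o : O) : ℝ :=
  (dotProduct (star (honestState P μ w))
    (Matrix.mulVec (extractOp out o) (honestState P μ w))).re

/-- The largest outcome probability for the honest state. -/
def maxProb (out : Walker P μ → O) (w : WalkSetting) : ℝ := ⨆ o, honestProb out w o

/-- The maximum probability, minimized over the settings of the family. -/
def minMaxProb (out : Walker P μ → O) (times : Finset ℕ) (c : CoinFamily) : ℝ :=
  sInf (maxProb out '' settings times c)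

/-- `G'`: position and memory coins are measured. -/
def guessMemory (P μ : ℕ) [NeZero P] (times : Finset ℕ) (c : CoinFamily) : ℝ :=
  minMaxProb (positionAndMemory (P := P) (μ := μ)) times c

/-- `G''`: only the position is measured. -/
def guessPosition (P μ : ℕ) [NeZero P] (times : Finset ℕ) (c : CoinFamily) : ℝ :=
  minMaxProb (positionOnly (P := P) (μ := μ)) times c

/-! ### The protocol -/

variable {N m : ℕ}

/-- The subsets of the `N` positions that have size `m`. -/
abbrev Sample (N m : ℕ) : Type := {t : Finset (Fin N) // t.card = m}

/-- The sampled positions, in increasing order. -/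
def Sample.pos (t : Sample N m) : Fin m ↪o Fin N := t.1.orderEmbOfFin t.2

/-- The positions outside the sample, in increasing order. -/
def Sample.rest (t : Sample N m) : Fin (N - m) ↪o Fin N :=
  (t.1ᶜ).orderEmbOfFin (by rw [Finset.card_compl, t.2, Fintype.card_fin])

/-- Basis labels of `N` walkers. -/
abbrev Walkers (P μ N : ℕ) : Type := Fin N → Walker P μ

/-- The tensor product operator on `N` walkers with factors `X` on the sampled walkers and `Y`
on the others. -/
def tensorOp (t : Sample N m) (X : Fin m → WalkerOp P μ) (Y : Fin (N - m) → WalkerOp P μ) :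
    Matrix (Walkers P μ N) (Walkers P μ N) ℂ :=
  Matrix.of fun a b =>
    (∏ j, X j (a (t.pos j)) (b (t.pos j))) * ∏ j, Y j (a (t.rest j)) (b (t.rest j))

/-- The test measurement `{[w_0], I - [w_0]}`, with outcomes `0` and `1`. -/
def testOp (P μ : ℕ) [NeZero P] (w : WalkSetting) (b : Fin 2) : WalkerOp P μ :=
  let p := Matrix.vecMulVec (honestState P μ w) (star (honestState P μ w))
  if b = 0 then p else 1 - p

/-- The relative Hamming weight of the test outcome. -/
def relWeight (q : Fin m → Fin 2) : ℝ := (hammingNorm q : ℝ) / m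

variable {E : Type*} [NormedAddCommGroup E] [InnerProductSpace ℂ E]

/-- A vector of `H_A ⊗ H_E`, where `H_A` is the space of `N` walkers, written as
`∑ a, |a⟩ ⊗ ψ a` with `ψ a` in `H_E`. -/
abbrev JointVector (P μ N : ℕ) [NeZero P] (E : Type*) [NormedAddCommGroup E]
    [InnerProductSpace ℂ E] : Type _ :=
  PiLp 2 fun _ : Walkers P μ N => E

/-- `⟨ψ| (L ⊗ I_E) |ψ⟩`. -/
def expectation (ψ : JointVector P μ N E) (L : Matrix (Walkers P μ N) (Walkers P μ N) ℂ) : ℝ :=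
  (∑ a, ∑ b, L b a * inner ℂ (ψ b) (ψ a)).re

/-- `Tr_A ((L ⊗ I_E) |ψ⟩⟨ψ|)`, an operator on `H_E`. -/
def reducedOp (ψ : JointVector P μ N E) (L : Matrix (Walkers P μ N) (Walkers P μ N) ℂ) :
    E →L[ℂ] E :=
  ∑ a, ∑ b, L b a • InnerProductSpace.rankOne ℂ (ψ a) (ψ b)

/-- The probability of the test outcome `q` if the sample is `t`. -/
def testProb (w : WalkSetting) (ψ : JointVector P μ N E) (t : Sample N m)
    (q : Fin m → Fin 2) : ℝ :=
  expectation ψ (tensorOp t (fun j => testOp P μ w (q j)) fun _ => 1)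

/-- The probability that the sample is `t` (uniform) and the test outcome is `q`. -/
def sampleProb (w : WalkSetting) (ψ : JointVector P μ N E) (t : Sample N m)
    (q : Fin m → Fin 2) : ℝ :=
  (N.choose m : ℝ)⁻¹ * testProb w ψ t q

/-- The block at `z` of the classical-quantum state `ρ_ZE = ∑ z, [z] ⊗ ρ_E^z` of the raw string
and Eve's system, conditioned on the sample `t` and the test outcome `q`. -/
def rawBlock (out : Walker P μ → O) (w : WalkSetting) (ψ : JointVector P μ N E)
    (t : Sample N m) (q : Fin m → Fin 2) (z : Fin (N - m) → O) : E →L[ℂ] E :=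
  (((testProb w ψ t q)⁻¹ : ℝ) : ℂ) •
    reducedOp ψ (tensorOp t (fun j => testOp P μ w (q j)) fun j => extractOp out (z j))

/-- The trace norm of an operator on a Hilbert space, as the supremum of `∑ i, |⟨e i, T (f i)⟩|`
over finite orthonormal families `e` and `f`. -/
def traceNorm (T : E →L[ℂ] E) : ENNReal :=
  ⨆ (k : ℕ) (e : Fin k → E) (f : Fin k → E) (_ : Orthonormal ℂ e) (_ : Orthonormal ℂ f),
    ∑ i, ‖inner ℂ (e i) (T (f i))‖ₑ

/-- A random function is two-universal if distinct inputs collide with probability at most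
`1 / |Y|`. -/
def TwoUniversal {Z Y : Type} [Fintype Z] [DecidableEq Z] [Fintype Y] [DecidableEq Y]
    (h : PMF (Z → Y)) : Prop :=
  ∀ z z' : Z, z ≠ z' → (∑ f : Z → Y, if f z = f z' then h f else 0) ≤ (Fintype.card Y : ENNReal)⁻¹

/-- The distance `‖ρ_YEH - (I_Y / 2^ℓ) ⊗ ρ_EH‖` in trace norm of the final string
`Y = f(Z) ∈ {0,1}^ℓ` from an ideal one, given Eve's system and the description `H` of the hash
function `f` drawn from `h`. The operator is block diagonal in `f` and `y`. -/
def distFromIdeal {Z : Type} [Fintype Z] [DecidableEq Z] {l : ℕ}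
    (h : PMF (Z → Fin l → Fin 2)) (ρ : Z → E →L[ℂ] E) : ENNReal :=
  ∑ f : Z → Fin l → Fin 2, h f * ∑ y : Fin l → Fin 2,
    traceNorm ((∑ z with f z = y, ρ z) - ((2 : ℂ) ^ l)⁻¹ • ∑ z, ρ z)

/-! ### Parameters -/

/-- The `d`-ary entropy function. -/
def entropy (d : ℕ) (x : ℝ) : ℝ :=
  x * Real.logb d (d - 1) - x * Real.logb d x - (1 - x) * Real.logb d (1 - x)

/-- The extended `d`-ary entropy function. -/
def extEntropy (d : ℕ) (x : ℝ) : ℝ :=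
  if x < 0 then 0 else if x ≤ 1 - 1 / (d : ℝ) then entropy d x else 1

/-- `δ = √((N + 2) ln (2 / ε²) / (m N))`. -/
def sampleError (N m : ℕ) (ε : ℝ) : ℝ :=
  Real.sqrt ((N + 2) * Real.log (2 / ε ^ 2) / (m * N))

/-- `η_q = (N - m) (1 - w(q) - δ)`. -/
def etaQ (N m : ℕ) (ε : ℝ) (q : Fin m → Fin 2) : ℝ :=
  ((N : ℝ) - m) * (1 - relWeight q - sampleError N m ε)

/-- `ℓ' = η_q γ - n H̄_d(w(q) + δ) / log_d 2 - 2 log₂ (1 / ε)`, with `n = N - m`. -/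
def stringLength (d N m : ℕ) (γ ε : ℝ) (q : Fin m → Fin 2) : ℝ :=
  etaQ N m ε q * γ
    - ((N : ℝ) - m) * (extEntropy d (relWeight q + sampleError N m ε) / Real.logb d 2)
    - 2 * Real.logb 2 (1 / ε)

open Classical in
/-- The probability, over the sample and the test outcome `q`, that the string of `len q` bits
produced by privacy amplification is not `c`-close to ideal. -/
def failureProb (out : Walker P μ → O) (w : WalkSetting) (ψ : JointVector P μ N E)
    (hash : ∀ l : ℕ, PMF ((Fin (N - m) → O) → Fin l → Fin 2))
    (len : (Fin m → Fin 2) → ℕ) (c : ℝ) : ℝ :=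
  ∑ t : Sample N m, ∑ q : Fin m → Fin 2,
    if distFromIdeal (hash (len q)) (rawBlock out w ψ t q) ≤ ENNReal.ofReal c then 0
    else sampleProb w ψ t q

end

end QWRNG

/-! The honest state is the column at `0` of a unitary $U$, so testing a walker amounts to asking
whether its label in the basis of the columns of $U$ is $0$. In that basis the input is a
superposition of words of $N$ letters. The event that the sample misjudges the remaining walkers is
diagonal there, so it suffices to fix one word and let only $t$ be random. Serfling's inequality
(`sum_exp_sampling_le`, `card_bad_sample_le`) shows that, for at most a fraction $\varepsilon^2$ of
the samples, the relative weight outside the sample exceeds the weight inside by more than $\delta$.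
Deleting the misjudged words replaces the real vectors by ideal ones, with average squared error at
most $\varepsilon^2$ (`sum_sum_error_le`).

Ideal vectors are superpositions of the words in a Hamming ball $J$. Such a word has at least
$\eta_q$ letters $0$, so it yields any given raw string with probability at most $G^{\eta_q}$. By
Cauchy–Schwarz a superposition loses at most a factor $|J|$ (`idealVec_min_entropy`), which the
entropy function bounds (`card_hammingBall_le`). The length $\ell'$ is exactly what the leftover
hash lemma (`distFromIdeal_le_of_min_entropy`) converts into distance $\varepsilon$.

Let $p$ be the probability of $q$ given $t$, and $e$ the squared error of that pair. Returning to
the real vectors costs $4\sqrt{e/p}$ (`distFromIdeal_rawBlock_le`). By Markov's inequality, $e>r^2p$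
has probability at most $\varepsilon^2/r^2$; for $r=\varepsilon+\varepsilon^{1/3}/2$ this is at most
$\varepsilon^{1/3}$, and otherwise the distance is at most
$\varepsilon+4r=5\varepsilon+2\varepsilon^{1/3}$. -/

namespace QWRNG

open scoped ComplexConjugate

/-! ### Trace norm and stability of the distance from ideal. -/

section TraceNorm

variable {E : Type*} [NormedAddCommGroup E] [InnerProductSpace ℂ E]

theorem sum_enorm_inner_le_traceNorm (T : E →L[ℂ] E) {k : ℕ} {e f : Fin k → E}
    (he : Orthonormal ℂ e) (hf : Orthonormal ℂ f) :
    ∑ i, ‖inner ℂ (e i) (T (f i))‖ₑ ≤ traceNorm T :=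
  le_iSup_of_le k <| le_iSup₂_of_le (f := fun (_ _ : Fin k → E) => _) e f <|
    le_iSup₂_of_le he hf le_rfl

theorem traceNorm_add_le (S T : E →L[ℂ] E) :
    traceNorm (S + T) ≤ traceNorm S + traceNorm T := by
  refine iSup_le fun k => iSup_le fun e => iSup_le fun f => iSup_le fun he => iSup_le fun hf => ?_
  calc ∑ i, ‖inner ℂ (e i) ((S + T) (f i))‖ₑ
      ≤ ∑ i, (‖inner ℂ (e i) (S (f i))‖ₑ + ‖inner ℂ (e i) (T (f i))‖ₑ) := by
        refine Finset.sum_le_sum fun i _ => ?_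
        rw [add_apply, inner_add_right]
        exact enorm_add_le _ _
    _ = _ := Finset.sum_add_distrib
    _ ≤ _ := add_le_add
        (sum_enorm_inner_le_traceNorm S he hf) (sum_enorm_inner_le_traceNorm T he hf)

theorem traceNorm_smul_le (c : ℂ) (T : E →L[ℂ] E) :
    traceNorm (c • T) ≤ ‖c‖ₑ * traceNorm T := by
  refine iSup_le fun k => iSup_le fun e => iSup_le fun f => iSup_le fun he => iSup_le fun hf => ?_
  calc ∑ i, ‖inner ℂ (e i) ((c • T) (f i))‖ₑ
      = ‖c‖ₑ * ∑ i, ‖inner ℂ (e i) (T (f i))‖ₑ := by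
        rw [Finset.mul_sum]
        refine Finset.sum_congr rfl fun i _ => ?_
        rw [smul_apply, inner_smul_right, enorm_mul]
    _ ≤ _ := by
        gcongr
        exact sum_enorm_inner_le_traceNorm T he hf

theorem traceNorm_zero : traceNorm (0 : E →L[ℂ] E) = 0 := by
  have := traceNorm_smul_le (0 : ℂ) (0 : E →L[ℂ] E)
  simpa using this

theorem traceNorm_sum_le {ι : Type*} (s : Finset ι) (T : ι → E →L[ℂ] E) :
    traceNorm (∑ i ∈ s, T i) ≤ ∑ i ∈ s, traceNorm (T i) :=
  Finset.le_sum_of_subadditive _ traceNorm_zero.le traceNorm_add_le s T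

theorem traceNorm_rankOne_le (x y : E) :
    traceNorm (InnerProductSpace.rankOne ℂ x y) ≤ ENNReal.ofReal (‖x‖ * ‖y‖) := by
  refine iSup_le fun k => iSup_le fun e => iSup_le fun f => iSup_le fun he => iSup_le fun hf => ?_
  simp_rw [← ofReal_norm]
  rw [← ENNReal.ofReal_sum_of_nonneg fun i _ => norm_nonneg _]
  refine ENNReal.ofReal_le_ofReal ?_
  calc ∑ i, ‖inner ℂ (e i) (InnerProductSpace.rankOne ℂ x y (f i))‖
      = ∑ i, ‖inner ℂ (e i) x‖ * ‖inner ℂ (f i) y‖ := by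
        refine Finset.sum_congr rfl fun i _ => ?_
        rw [InnerProductSpace.rankOne_apply, inner_smul_right, norm_mul, norm_inner_symm y, mul_comm]
    _ ≤ √(∑ i, ‖inner ℂ (e i) x‖ ^ 2) * √(∑ i, ‖inner ℂ (f i) y‖ ^ 2) :=
        Real.sum_mul_le_sqrt_mul_sqrt _ _ _
    _ ≤ √(‖x‖ ^ 2) * √(‖y‖ ^ 2) := by
        gcongr
        · exact he.sum_inner_products_le x
        · exact hf.sum_inner_products_le y
    _ = _ := by simp

theorem traceNorm_rankOne_self_sub_le (x y : E) :
    traceNorm (InnerProductSpace.rankOne ℂ x x - InnerProductSpace.rankOne ℂ y y)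
      ≤ ENNReal.ofReal ((‖x‖ + ‖y‖) * ‖x - y‖) := by
  have h : InnerProductSpace.rankOne ℂ x x - InnerProductSpace.rankOne ℂ y y
      = InnerProductSpace.rankOne ℂ x (x - y) + InnerProductSpace.rankOne ℂ (x - y) y := by
    simp [map_sub]
  rw [h, add_mul, ENNReal.ofReal_add (by positivity) (by positivity)]
  refine (traceNorm_add_le _ _).trans (add_le_add (traceNorm_rankOne_le _ _) ?_)
  rw [mul_comm ‖y‖]
  exact traceNorm_rankOne_le _ _

variable {Z : Type} [Fintype Z] [DecidableEq Z] {l : ℕ}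

theorem sum_pmf_eq_one {α : Type*} [Fintype α] (h : PMF α) : ∑ f, h f = 1 := by
  rw [← tsum_fintype (L := .unconditional _)]; exact h.tsum_coe

/-- The perturbation enters twice, through the hashed blocks and through the uniform comparison
state, hence the factor 2. -/
theorem distFromIdeal_le_add (h : PMF (Z → Fin l → Fin 2)) (ρ τ : Z → E →L[ℂ] E) :
    distFromIdeal h ρ ≤ distFromIdeal h τ + 2 * ∑ z, traceNorm (ρ z - τ z) := by
  have key : ∀ f : Z → Fin l → Fin 2,
      ∑ y : Fin l → Fin 2, traceNorm ((∑ z with f z = y, ρ z) - ((2 : ℂ) ^ l)⁻¹ • ∑ z, ρ z)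
      ≤ ∑ y : Fin l → Fin 2, traceNorm ((∑ z with f z = y, τ z) - ((2 : ℂ) ^ l)⁻¹ • ∑ z, τ z)
        + 2 * ∑ z, traceNorm (ρ z - τ z) := by
    intro f
    have hy : ∀ y : Fin l → Fin 2,
        traceNorm ((∑ z with f z = y, ρ z) - ((2 : ℂ) ^ l)⁻¹ • ∑ z, ρ z)
        ≤ traceNorm ((∑ z with f z = y, τ z) - ((2 : ℂ) ^ l)⁻¹ • ∑ z, τ z)
          + (∑ z with f z = y, traceNorm (ρ z - τ z)
            + (2 ^ l : ENNReal)⁻¹ * ∑ z, traceNorm (ρ z - τ z)) := by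
      intro y
      have e : (∑ z with f z = y, ρ z) - ((2 : ℂ) ^ l)⁻¹ • ∑ z, ρ z
          = ((∑ z with f z = y, τ z) - ((2 : ℂ) ^ l)⁻¹ • ∑ z, τ z)
            + ((∑ z with f z = y, (ρ z - τ z)) + (-((2 : ℂ) ^ l)⁻¹) • ∑ z, (ρ z - τ z)) := by
        simp only [Finset.sum_sub_distrib, smul_sub, neg_smul]
        abel
      rw [e]
      refine (traceNorm_add_le _ _).trans (add_le_add le_rfl
        ((traceNorm_add_le _ _).trans (add_le_add (traceNorm_sum_le _ _) ?_)))
      refine (traceNorm_smul_le _ _).trans ?_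
      have : ‖-((2 : ℂ) ^ l)⁻¹‖ₑ = (2 ^ l : ENNReal)⁻¹ := by
        rw [enorm_neg, enorm_inv (pow_ne_zero _ two_ne_zero), enorm_pow]
        congr 2
        rw [← ofReal_norm]
        simp
      rw [this]
      gcongr
      exact traceNorm_sum_le _ _
    refine (Finset.sum_le_sum fun y _ => hy y).trans ?_
    rw [Finset.sum_add_distrib, Finset.sum_add_distrib, Finset.sum_fiberwise, Finset.sum_const,
      Finset.card_univ, Fintype.card_fun, Fintype.card_fin, Fintype.card_fin, nsmul_eq_mul,
      ← mul_assoc, Nat.cast_pow, Nat.cast_ofNat, ENNReal.mul_inv_cancel (by positivity)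
      (ENNReal.pow_ne_top ENNReal.ofNat_ne_top), one_mul, two_mul]
  calc distFromIdeal h ρ
      ≤ ∑ f : Z → Fin l → Fin 2, (h f * ∑ y : Fin l → Fin 2,
          traceNorm ((∑ z with f z = y, τ z) - ((2 : ℂ) ^ l)⁻¹ • ∑ z, τ z)
          + h f * (2 * ∑ z, traceNorm (ρ z - τ z))) := by
        refine Finset.sum_le_sum fun f _ => ?_
        rw [← mul_add]
        gcongr
        exact key f
    _ = _ := by
        rw [Finset.sum_add_distrib, ← Finset.sum_mul, sum_pmf_eq_one, one_mul]
        rfl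

theorem distFromIdeal_smul_le (h : PMF (Z → Fin l → Fin 2)) (c : ℂ) (ρ : Z → E →L[ℂ] E) :
    distFromIdeal h (fun z => c • ρ z) ≤ ‖c‖ₑ * distFromIdeal h ρ := by
  unfold distFromIdeal
  rw [Finset.mul_sum]
  refine Finset.sum_le_sum fun f _ => ?_
  rw [mul_left_comm, Finset.mul_sum (a := ‖c‖ₑ)]
  gcongr with y
  refine le_trans (le_of_eq ?_) (traceNorm_smul_le _ _)
  rw [← Finset.smul_sum, ← Finset.smul_sum, smul_sub, smul_comm c]

theorem distFromIdeal_length_zero (h : PMF (Z → Fin 0 → Fin 2)) (ρ : Z → E →L[ℂ] E) :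
    distFromIdeal h ρ = 0 := by
  unfold distFromIdeal
  refine Finset.sum_eq_zero fun f _ => ?_
  have : ∀ y : Fin 0 → Fin 2, (∑ z with f z = y, ρ z) - ((2 : ℂ) ^ 0)⁻¹ • ∑ z, ρ z = 0 := by
    intro y
    have : (Finset.univ.filter fun z => f z = y) = Finset.univ := by
      ext z; simp [Subsingleton.elim (f z) y]
    rw [this]; simp
  rw [Finset.sum_eq_zero fun y _ => by rw [this y, traceNorm_zero], mul_zero]

end TraceNorm

/-! ### Leftover hash lemma against quantum side information. -/

section LeftoverHash

variable {E : Type*} [NormedAddCommGroup E] [InnerProductSpace ℂ E]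

/-- The vectors `g` are eigenvectors of $\rho=\sum_x|v_x\rangle\langle v_x|$ on the span of the `v
x`, which is finite-dimensional whatever `E` is; `s` lists the eigenvalues. -/
theorem exists_orthonormal_diagonalizing {X : Type*} [Fintype X] (v : X → E) :
    ∃ (n : ℕ) (g : Fin n → E) (s : Fin n → ℝ), Orthonormal ℂ g ∧
      (∀ x, ∑ k, inner ℂ (g k) (v x) • g k = v x) ∧
      ∀ k l, ∑ x, inner ℂ (g k) (v x) * inner ℂ (v x) (g l) = if k = l then (s k : ℂ) else 0 := by
  let F := Submodule.span ℂ (Set.range v)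
  have : FiniteDimensional ℂ F := FiniteDimensional.span_of_finite ℂ (Set.finite_range v)
  let u : X → F := fun x => ⟨v x, Submodule.subset_span ⟨x, rfl⟩⟩
  let T : F →ₗ[ℂ] F := ∑ x, (InnerProductSpace.rankOne ℂ (u x) (u x)).toLinearMap
  have hTa : ∀ w, T w = ∑ x, inner ℂ (u x) w • u x := by
    intro w; simp [T, LinearMap.sum_apply]
  have hT : T.IsSymmetric := by
    intro a b
    rw [hTa, hTa, sum_inner, inner_sum]
    refine Finset.sum_congr rfl fun x _ => ?_
    rw [inner_smul_left, inner_smul_right, inner_conj_symm, mul_comm]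
  let b := hT.eigenvectorBasis rfl
  refine ⟨_, fun k => (b k : E), hT.eigenvalues rfl, ?_, ?_, ?_⟩
  · have := b.orthonormal
    exact this.comp_linearIsometry F.subtypeₗᵢ
  · intro x
    have := congrArg (Subtype.val) (b.sum_repr' (u x))
    simpa using this
  · intro k l
    have h1 : inner ℂ (b k) (T (b l)) = if k = l then (hT.eigenvalues rfl k : ℂ) else 0 := by
      rw [hT.apply_eigenvectorBasis, inner_smul_right, b.inner_eq_ite]
      split_ifs with h
      · rw [h]; simp
      · simp
    rw [← h1, hTa, inner_sum]
    refine Finset.sum_congr rfl fun x _ => ?_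
    rw [inner_smul_right, mul_comm]
    rfl

/-- The inner sum is, up to conjugation, the coefficient of a single vector $w$ along $g_j$.
Bessel's inequality for `g`, orthonormality of `e` and Bessel's inequality for `f` then give
$\sum_j|\langle g_j,w\rangle|^2\le\|w\|^2\le\|a\|^2$. -/
theorem sum_norm_sq_mixed_le {k n : ℕ} {e f : Fin k → E} {g : Fin n → E}
    (he : Orthonormal ℂ e) (hf : Orthonormal ℂ f) (hg : Orthonormal ℂ g) {u : Fin k → ℂ}
    (hu : ∀ i, ‖u i‖ = 1) (a : E) :
    ∑ j, ‖∑ i, u i * inner ℂ (e i) (g j) * inner ℂ a (f i)‖ ^ 2 ≤ ‖a‖ ^ 2 := by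
  let w : E := ∑ i, conj (u i * inner ℂ a (f i)) • e i
  have h1 : ∀ j, ‖∑ i, u i * inner ℂ (e i) (g j) * inner ℂ a (f i)‖ = ‖inner ℂ (g j) w‖ := by
    intro j
    rw [norm_inner_symm, sum_inner]
    congr 1
    refine Finset.sum_congr rfl fun i _ => ?_
    rw [inner_smul_left, RingHomCompTriple.comp_apply, RingHom.id_apply]
    ring
  simp_rw [h1]
  refine (hg.sum_inner_products_le w).trans ?_
  have h2 : ‖w‖ ^ 2 = ∑ i, ‖inner ℂ (f i) a‖ ^ 2 := by
    have : (inner ℂ w w : ℂ) = ∑ i, ((‖inner ℂ (f i) a‖ ^ 2 : ℝ) : ℂ) := by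
      rw [he.inner_sum]
      refine Finset.sum_congr rfl fun i _ => ?_
      rw [Complex.conj_mul', Complex.norm_conj, norm_mul, hu, one_mul, norm_inner_symm]
      simp
    rw [inner_self_eq_norm_sq_to_K] at this
    exact Complex.ofReal_injective (by rw [Complex.ofReal_sum, ← this]; simp)
  rw [h2]
  exact hf.sum_inner_products_le a

/-- Hölder's inequality $\|T\|_1\le\|D^{-1/2}TD^{-1/2}\|_2\,\|D\|_2$ for $D=\mathrm{diag}(r)$,
written in coordinates so that no operator roots are needed. -/
theorem traceNorm_le_of_coordinates {n : ℕ} {g : Fin n → E} (hg : Orthonormal ℂ g)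
    (A : Fin n → Fin n → ℂ) (r : Fin n → ℝ) (hr : ∀ k, 0 ≤ r k)
    (hA : ∀ k l, r k * r l = 0 → A k l = 0) (T : E →L[ℂ] E)
    (hT : ∀ a b, inner ℂ a (T b) = ∑ k, ∑ l, A k l * (inner ℂ a (g k) * inner ℂ (g l) b)) :
    traceNorm T ≤ ENNReal.ofReal
      (√(∑ k, ∑ l, ‖A k l‖ ^ 2 / (r k * r l)) * √(∑ k, r k ^ 2)) := by
  refine iSup_le fun N => iSup_le fun e => iSup_le fun f => iSup_le fun he => iSup_le fun hf => ?_
  simp_rw [← ofReal_norm]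
  rw [← ENNReal.ofReal_sum_of_nonneg fun i _ => norm_nonneg _]
  refine ENNReal.ofReal_le_ofReal ?_
  -- The phases `u i` make the absolute values linear in $T$. The matrix `Y` dual to `A` is that of
  -- a contraction, so its rows and columns have norm at most 1.
  choose u hu1 hu2 using fun i : Fin N => RCLike.exists_norm_eq_mul_self (inner ℂ (e i) (T (f i)))
  let Y : Fin n → Fin n → ℂ := fun k l => ∑ i, u i * inner ℂ (e i) (g k) * inner ℂ (g l) (f i)
  have hY1 : ∀ l, ∑ k, ‖Y k l‖ ^ 2 ≤ 1 := by
    intro l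
    refine (sum_norm_sq_mixed_le he hf hg hu1 (g l)).trans ?_
    rw [hg.1 l]; norm_num
  have hY2 : ∀ k, ∑ l, ‖Y k l‖ ^ 2 ≤ 1 := by
    intro k
    have : ∀ l, ‖Y k l‖
        = ‖∑ i, conj (u i) * inner ℂ (f i) (g l) * inner ℂ (g k) (e i)‖ := by
      intro l
      rw [← Complex.norm_conj, map_sum]
      congr 1
      refine Finset.sum_congr rfl fun i _ => ?_
      rw [map_mul, map_mul, inner_conj_symm, inner_conj_symm]
      ring
    simp_rw [this]
    refine (sum_norm_sq_mixed_le hf he hg (fun i => by rw [Complex.norm_conj, hu1]) (g k)).trans ?_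
    rw [hg.1 k]; norm_num
  have hsum : ((∑ i, ‖inner ℂ (e i) (T (f i))‖ : ℝ) : ℂ) = ∑ k, ∑ l, A k l * Y k l := by
    push_cast
    calc ∑ i, ((‖inner ℂ (e i) (T (f i))‖ : ℝ) : ℂ)
        = ∑ i, ∑ k, ∑ l, A k l * (u i * inner ℂ (e i) (g k) * inner ℂ (g l) (f i)) := by
          refine Finset.sum_congr rfl fun i _ => ?_
          refine (hu2 i).trans ?_
          rw [hT, Finset.mul_sum]
          refine Finset.sum_congr rfl fun k _ => ?_
          rw [Finset.mul_sum]
          exact Finset.sum_congr rfl fun l _ => by ring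
      _ = _ := by
          rw [Finset.sum_comm]
          refine Finset.sum_congr rfl fun k _ => ?_
          rw [Finset.sum_comm]
          refine Finset.sum_congr rfl fun l _ => ?_
          rw [Finset.mul_sum]
  have hle : ∑ i, ‖inner ℂ (e i) (T (f i))‖ ≤ ∑ p : Fin n × Fin n, ‖A p.1 p.2‖ * ‖Y p.1 p.2‖ := by
    calc ∑ i, ‖inner ℂ (e i) (T (f i))‖ = ‖((∑ i, ‖inner ℂ (e i) (T (f i))‖ : ℝ) : ℂ)‖ := by
          rw [Complex.norm_real, Real.norm_of_nonneg (Finset.sum_nonneg fun i _ => norm_nonneg _)]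
      _ ≤ _ := by
          rw [hsum, ← Fintype.sum_prod_type' (f := fun k l => A k l * Y k l)]
          refine (norm_sum_le _ _).trans (le_of_eq ?_)
          exact Finset.sum_congr rfl fun p _ => norm_mul _ _
  have hCS : ∑ p : Fin n × Fin n, ‖A p.1 p.2‖ * ‖Y p.1 p.2‖
      ≤ √(∑ p : Fin n × Fin n, (‖A p.1 p.2‖ / √(r p.1 * r p.2)) ^ 2)
        * √(∑ p : Fin n × Fin n, (√(r p.1 * r p.2) * ‖Y p.1 p.2‖) ^ 2) := by
    refine le_trans (le_of_eq ?_) (Real.sum_mul_le_sqrt_mul_sqrt _ _ _)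
    refine Finset.sum_congr rfl fun p _ => ?_
    rcases eq_or_ne (r p.1 * r p.2) 0 with h | h
    · rw [hA _ _ h]; simp
    · have : √(r p.1 * r p.2) ≠ 0 :=
        (Real.sqrt_pos.2 (lt_of_le_of_ne (mul_nonneg (hr _) (hr _)) h.symm)).ne'
      field_simp
  refine hle.trans (hCS.trans ?_)
  have e1 : ∑ p : Fin n × Fin n, (‖A p.1 p.2‖ / √(r p.1 * r p.2)) ^ 2
      = ∑ k, ∑ l, ‖A k l‖ ^ 2 / (r k * r l) := by
    rw [Fintype.sum_prod_type]
    refine Finset.sum_congr rfl fun k _ => Finset.sum_congr rfl fun l _ => ?_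
    rw [div_pow, Real.sq_sqrt (mul_nonneg (hr _) (hr _))]
  -- Use $r_kr_l\le(r_k^2+r_l^2)/2$, then the column and row bounds on `Y`.
  have e2 : ∑ p : Fin n × Fin n, (√(r p.1 * r p.2) * ‖Y p.1 p.2‖) ^ 2 ≤ ∑ k, r k ^ 2 := by
    calc ∑ p : Fin n × Fin n, (√(r p.1 * r p.2) * ‖Y p.1 p.2‖) ^ 2
        ≤ ∑ p : Fin n × Fin n, (r p.1 ^ 2 / 2 * ‖Y p.1 p.2‖ ^ 2
            + r p.2 ^ 2 / 2 * ‖Y p.1 p.2‖ ^ 2) := by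
          refine Finset.sum_le_sum fun p _ => ?_
          rw [mul_pow, Real.sq_sqrt (mul_nonneg (hr _) (hr _)), ← add_mul]
          gcongr
          nlinarith [sq_nonneg (r p.1 - r p.2)]
      _ = ∑ k, r k ^ 2 / 2 * ∑ l, ‖Y k l‖ ^ 2 + ∑ l, r l ^ 2 / 2 * ∑ k, ‖Y k l‖ ^ 2 := by
          rw [Finset.sum_add_distrib, Fintype.sum_prod_type, Fintype.sum_prod_type_right]
          simp_rw [Finset.mul_sum]
      _ ≤ ∑ k, r k ^ 2 / 2 * 1 + ∑ l, r l ^ 2 / 2 * 1 := by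
          gcongr with k _ l _
          · exact hY2 k
          · exact hY1 l
      _ = _ := by
          rw [← Finset.sum_add_distrib]
          exact Finset.sum_congr rfl fun k _ => by ring
  rw [e1]
  gcongr

/-- The kernel is $K(x,x')=|\langle v_{x'},\rho^{-1/2}v_x\rangle|^2$ with
$\rho=\sum_x|v_x\rangle\langle v_x|$ and the inverse root taken on the support. The quadratic form
of $c$ is then $\mathrm{Tr}(T\rho^{-1/2}T\rho^{-1/2})$ for $T=\sum_xc_x|v_x\rangle\langle v_x|$. The
last clause, with $e=\rho^{-1/2}v_{x'}$, is what lets a min-entropy bound be applied to each column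
of $K$. -/
theorem exists_collision_kernel {X : Type*} [Fintype X] (v : X → E) :
    ∃ K : X → X → ℝ, (∀ x x', 0 ≤ K x x') ∧
      (∀ c : X → ℝ, 0 ≤ ∑ x, ∑ x', c x * c x' * K x x') ∧
      (∀ c : X → ℝ, traceNorm (∑ x, (c x : ℂ) • InnerProductSpace.rankOne ℂ (v x) (v x))
        ≤ ENNReal.ofReal (√(∑ x, ∑ x', c x * c x' * K x x') * √(∑ x, ‖v x‖ ^ 2))) ∧
      ∀ x', ∃ e : E, (∀ x, K x x' = ‖inner ℂ e (v x)‖ ^ 2) ∧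
        ∑ x, ‖inner ℂ e (v x)‖ ^ 2 = ‖v x'‖ ^ 2 := by
  obtain ⟨n, g, s, hg, hv, hs⟩ := exists_orthonormal_diagonalizing v
  set a : X → Fin n → ℂ := fun x k => inner ℂ (g k) (v x) with ha
  have hs' : ∀ k, s k = ∑ x, ‖a x k‖ ^ 2 := by
    intro k
    have := hs k k
    rw [if_pos rfl] at this
    apply Complex.ofReal_injective
    rw [← this]
    push_cast
    refine Finset.sum_congr rfl fun x _ => ?_
    rw [← Complex.mul_conj', inner_conj_symm]
  have hs0 : ∀ k, 0 ≤ s k := fun k => by rw [hs']; positivity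
  have haz : ∀ k, s k = 0 → ∀ x, a x k = 0 := by
    intro k hk x
    rw [hs', Finset.sum_eq_zero_iff_of_nonneg fun x _ => by positivity] at hk
    simpa using hk x (Finset.mem_univ x)
  set r : Fin n → ℝ := fun k => √(s k) with hr
  have hr2 : ∀ k, r k ^ 2 = s k := fun k => Real.sq_sqrt (hs0 k)
  have hrz : ∀ k, r k = 0 → ∀ x, a x k = 0 := fun k hk =>
    haz k ((Real.sqrt_eq_zero (hs0 k)).1 hk)
  have hvn : ∀ x, ‖v x‖ ^ 2 = ∑ k, ‖a x k‖ ^ 2 := by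
    intro x
    have : (inner ℂ (v x) (v x) : ℂ) = ∑ k, ((‖a x k‖ ^ 2 : ℝ) : ℂ) := by
      conv_lhs => rw [← hv x]
      rw [hg.inner_sum]
      refine Finset.sum_congr rfl fun k _ => ?_
      rw [Complex.conj_mul']
      simp [ha]
    rw [inner_self_eq_norm_sq_to_K] at this
    exact Complex.ofReal_injective (by rw [Complex.ofReal_sum, ← this]; simp)
  -- This is $\rho^{-1/2}v_{x'}$. Division by `r k = 0` is harmless, as `a x' k` vanishes there.
  let e : X → E := fun x' => ∑ k, (a x' k / r k) • g k
  have he : ∀ x' x, inner ℂ (e x') (v x) = ∑ k, conj (a x' k) / r k * a x k := by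
    intro x' x
    rw [sum_inner]
    refine Finset.sum_congr rfl fun k _ => ?_
    rw [inner_smul_left, map_div₀, Complex.conj_ofReal]
  have hQ : ∀ c : X → ℝ, ∑ k, ∑ l, ‖∑ x, c x * (a x k * conj (a x l))‖ ^ 2 / (r k * r l)
      = ∑ x, ∑ x', c x * c x' * ‖inner ℂ (e x') (v x)‖ ^ 2 := by
    intro c
    apply Complex.ofReal_injective
    push_cast
    have h1 : ∀ k l, ((‖∑ x, c x * (a x k * conj (a x l))‖ : ℂ)) ^ 2 / (r k * r l)
        = ∑ x, ∑ x', c x * c x' *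
        ((conj (a x' k) / r k * a x k) * conj (conj (a x' l) / r l * a x l)) := by
      intro k l
      rw [← Complex.mul_conj', map_sum, Finset.sum_mul_sum, Finset.sum_div]
      refine Finset.sum_congr rfl fun x _ => ?_
      rw [Finset.sum_div]
      refine Finset.sum_congr rfl fun x' _ => ?_
      simp only [map_mul, map_div₀, Complex.conj_conj, Complex.conj_ofReal]
      simp only [div_eq_mul_inv, mul_inv]
      ring
    have h2 : ∀ x x', ((‖inner ℂ (e x') (v x)‖ : ℂ)) ^ 2 = ∑ k, ∑ l,
        ((conj (a x' k) / r k * a x k) * conj (conj (a x' l) / r l * a x l)) := by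
      intro x x'
      rw [← Complex.mul_conj', he, map_sum, Finset.sum_mul_sum]
    simp_rw [h1, h2, Finset.mul_sum]
    rw [Finset.sum_congr rfl fun k _ => Finset.sum_comm]
    rw [Finset.sum_comm]
    refine Finset.sum_congr rfl fun x _ => ?_
    rw [Finset.sum_congr rfl fun k _ => Finset.sum_comm]
    rw [Finset.sum_comm]
  have hr0 : ∀ k, 0 ≤ r k := fun k => Real.sqrt_nonneg _
  refine ⟨fun x x' => ‖inner ℂ (e x') (v x)‖ ^ 2, fun x x' => by positivity, ?_, ?_,
    fun x' => ⟨e x', fun x => rfl, ?_⟩⟩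
  · intro c
    rw [← hQ]
    exact Finset.sum_nonneg fun k _ => Finset.sum_nonneg fun l _ =>
      div_nonneg (by positivity) (mul_nonneg (hr0 k) (hr0 l))
  · intro c
    let A : Fin n → Fin n → ℂ := fun k l => ∑ x, c x * (a x k * conj (a x l))
    have key := traceNorm_le_of_coordinates hg A r hr0 ?_
      (∑ x, (c x : ℂ) • InnerProductSpace.rankOne ℂ (v x) (v x)) ?_
    · refine key.trans (le_of_eq ?_)
      rw [hQ c]
      congr 3
      simp_rw [hr2, hvn, hs']
      rw [Finset.sum_comm]
    · intro k l hkl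
      refine Finset.sum_eq_zero fun x _ => ?_
      rcases mul_eq_zero.1 hkl with h | h
      · rw [hrz k h x]; simp
      · rw [hrz l h x]; simp
    · intro p q
      rw [sum_apply, inner_sum]
      have hx : ∀ x, inner ℂ p (((c x : ℂ) • InnerProductSpace.rankOne ℂ (v x) (v x)) q)
          = ∑ k, ∑ l, c x * (a x k * conj (a x l)) * (inner ℂ p (g k) * inner ℂ (g l) q) := by
        intro x
        rw [smul_apply, InnerProductSpace.rankOne_apply, inner_smul_right, inner_smul_right]
        have h1 : inner ℂ p (v x) = ∑ k, a x k * inner ℂ p (g k) := by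
          conv_lhs => rw [← hv x]
          rw [inner_sum]
          exact Finset.sum_congr rfl fun k _ => inner_smul_right _ _ _
        have h2 : inner ℂ (v x) q = ∑ l, conj (a x l) * inner ℂ (g l) q := by
          conv_lhs => rw [← hv x]
          rw [sum_inner]
          exact Finset.sum_congr rfl fun k _ => inner_smul_left _ _ _
        rw [h1, h2, mul_comm (∑ l, _), Finset.sum_mul_sum, Finset.mul_sum]
        refine Finset.sum_congr rfl fun k _ => ?_
        rw [Finset.mul_sum]
        exact Finset.sum_congr rfl fun l _ => by ring
      rw [Finset.sum_congr rfl fun x _ => hx x, Finset.sum_comm]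
      refine Finset.sum_congr rfl fun k _ => ?_
      rw [Finset.sum_comm]
      refine Finset.sum_congr rfl fun l _ => ?_
      rw [Finset.sum_mul]
  · apply Complex.ofReal_injective
    rw [hvn]
    push_cast
    have h2 : ∀ x, ((‖inner ℂ (e x') (v x)‖ : ℂ)) ^ 2 = ∑ k, ∑ l,
        (conj (a x' k) / r k * (a x' l / r l)) * (inner ℂ (g k) (v x) * inner ℂ (v x) (g l)) := by
      intro x
      rw [← Complex.mul_conj', he, map_sum, Finset.sum_mul_sum]
      refine Finset.sum_congr rfl fun k _ => Finset.sum_congr rfl fun l _ => ?_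
      simp only [map_mul, map_div₀, Complex.conj_ofReal, ha, inner_conj_symm]
      ring
    simp_rw [h2]
    rw [Finset.sum_comm]
    refine Finset.sum_congr rfl fun k _ => ?_
    rw [Finset.sum_comm]
    simp_rw [← Finset.mul_sum, hs]
    rw [Finset.sum_eq_single k (fun l _ hl => by rw [if_neg hl.symm, mul_zero]) (by simp),
      if_pos rfl, ← Complex.conj_mul']
    by_cases h : r k = 0
    · rw [hrz k h x']; simp
    · have h' : (r k : ℂ) ≠ 0 := by exact_mod_cast h
      rw [← hr2 k]
      push_cast
      field_simp

/-- The hypothesis `hv` is the operator inequality $\rho_z\le\lambda\rho$, tested on vectors. The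
squared 2-norms of the deviations from uniform, weighted by $\rho^{-1/4}$ on both sides, are
collision sums of the kernel. Averaging over the hash leaves only pairs with equal raw strings,
which `hv` bounds. -/
theorem distFromIdeal_le_of_min_entropy {X : Type*} [Fintype X] {Z : Type} [Fintype Z]
    [DecidableEq Z] {l : ℕ} (h : PMF (Z → Fin l → Fin 2)) (hh : TwoUniversal h)
    (v : X → E) (zf : X → Z) {lam : ℝ} (hlam : 0 ≤ lam)
    (hv : ∀ z, ∀ e : E, ∑ x with zf x = z, ‖inner ℂ e (v x)‖ ^ 2
      ≤ lam * ∑ x, ‖inner ℂ e (v x)‖ ^ 2) :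
    distFromIdeal h (fun z => ∑ x with zf x = z, InnerProductSpace.rankOne ℂ (v x) (v x))
      ≤ ENNReal.ofReal (√(2 ^ l * lam) * ∑ x, ‖v x‖ ^ 2) := by
  obtain ⟨K, hK0, hKc, hK1, hK2⟩ := exists_collision_kernel v
  set S := ∑ x, ‖v x‖ ^ 2 with hS
  have hS0 : 0 ≤ S := by positivity
  let c : (Z → Fin l → Fin 2) → (Fin l → Fin 2) → X → ℝ := fun f y x =>
    (if f (zf x) = y then 1 else 0) - (2 ^ l : ℝ)⁻¹
  let Q : (Z → Fin l → Fin 2) → (Fin l → Fin 2) → ℝ := fun f y =>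
    ∑ x, ∑ x', c f y x * c f y x' * K x x'
  let p : (Z → Fin l → Fin 2) → ℝ := fun f => (h f).toReal
  have hp0 : ∀ f, 0 ≤ p f := fun f => ENNReal.toReal_nonneg
  have hpf : ∀ f, h f = ENNReal.ofReal (p f) := fun f =>
    (ENNReal.ofReal_toReal (h.apply_ne_top f)).symm
  have hp1 : ∑ f, p f = 1 := by
    have := sum_pmf_eq_one h
    rw [← ENNReal.toReal_sum fun f _ => h.apply_ne_top f, this, ENNReal.toReal_one]
  have hop : ∀ f y, (∑ z with f z = y, ∑ x with zf x = z,
        InnerProductSpace.rankOne ℂ (v x) (v x))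
      - ((2 : ℂ) ^ l)⁻¹ • ∑ z, ∑ x with zf x = z, InnerProductSpace.rankOne ℂ (v x) (v x)
      = ∑ x, (c f y x : ℂ) • InnerProductSpace.rankOne ℂ (v x) (v x) := by
    intro f y
    rw [Finset.sum_fiberwise, Finset.smul_sum, Finset.sum_filter]
    have : ∀ z, (if f z = y then ∑ x with zf x = z, InnerProductSpace.rankOne ℂ (v x) (v x)
        else 0) = ∑ x with zf x = z, if f (zf x) = y then
          InnerProductSpace.rankOne ℂ (v x) (v x) else 0 := by
      intro z
      split_ifs with hz
      · refine Finset.sum_congr rfl fun x hx => ?_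
        rw [(Finset.mem_filter.1 hx).2, if_pos hz]
      · refine (Finset.sum_eq_zero fun x hx => ?_).symm
        rw [(Finset.mem_filter.1 hx).2, if_neg hz]
    rw [Finset.sum_congr rfl fun z _ => this z, Finset.sum_fiberwise, ← Finset.sum_sub_distrib]
    refine Finset.sum_congr rfl fun x _ => ?_
    simp only [c]
    split_ifs <;> simp [sub_smul]
  have hcc : ∀ f x x', ∑ y, c f y x * c f y x'
      = (if f (zf x) = f (zf x') then 1 else 0) - (2 ^ l : ℝ)⁻¹ := by
    intro f x x'
    simp only [c, sub_mul, mul_sub, Finset.sum_sub_distrib, ite_mul, one_mul, zero_mul, mul_ite,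
      mul_one, mul_zero, Finset.sum_ite_eq, Finset.mem_univ, if_true, Finset.sum_const,
      Finset.card_univ, Fintype.card_fun, Fintype.card_fin, nsmul_eq_mul]
    have : ((2 ^ l : ℕ) : ℝ) * ((2 ^ l : ℝ)⁻¹ * (2 ^ l : ℝ)⁻¹) = (2 ^ l : ℝ)⁻¹ := by
      push_cast
      field_simp
    rw [this]
    ring
  -- Two-universality in the form used: subtracting $2^{-l}$ cancels the accidental collisions of
  -- distinct strings.
  have hcoll : ∀ x x', ∑ f, p f * ((if f (zf x) = f (zf x') then 1 else 0) - (2 ^ l : ℝ)⁻¹)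
      ≤ if zf x = zf x' then 1 else 0 := by
    intro x x'
    simp_rw [mul_sub]
    rw [Finset.sum_sub_distrib, ← Finset.sum_mul, hp1, one_mul]
    split_ifs with hz
    · simp only [hz, if_true, mul_one, hp1]
      have : (0 : ℝ) ≤ (2 ^ l : ℝ)⁻¹ := by positivity
      linarith
    · have h2 := hh _ _ hz
      have h3 : ∑ f, p f * (if f (zf x) = f (zf x') then 1 else 0)
          = (∑ f, if f (zf x) = f (zf x') then h f else 0).toReal := by
        rw [ENNReal.toReal_sum fun f _ => by split_ifs <;> simp [h.apply_ne_top]]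
        refine Finset.sum_congr rfl fun f _ => ?_
        split_ifs <;> simp [p]
      have h4 : (∑ f, if f (zf x) = f (zf x') then h f else 0).toReal ≤ (2 ^ l : ℝ)⁻¹ := by
        refine (ENNReal.toReal_mono (by simp) h2).trans (le_of_eq ?_)
        simp
      rw [h3]
      linarith
  have hQ : ∑ f, ∑ y, p f * Q f y ≤ lam * S := by
    calc ∑ f, ∑ y, p f * Q f y
        = ∑ x, ∑ x', (∑ f, p f * ((if f (zf x) = f (zf x') then 1 else 0) - (2 ^ l : ℝ)⁻¹))
            * K x x' := by
          simp_rw [← hcc, Finset.mul_sum, Finset.sum_mul]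
          simp only [Q, Finset.mul_sum]
          have : ∀ f, ∑ y, ∑ x, ∑ x', p f * (c f y x * c f y x' * K x x')
              = ∑ x, ∑ x', ∑ y, p f * (c f y x * c f y x') * K x x' := by
            intro f
            rw [Finset.sum_comm]
            refine Finset.sum_congr rfl fun x _ => ?_
            rw [Finset.sum_comm]
            exact Finset.sum_congr rfl fun x' _ => Finset.sum_congr rfl fun y _ => by ring
          rw [Finset.sum_congr rfl fun f _ => this f, Finset.sum_comm]
          refine Finset.sum_congr rfl fun x _ => ?_
          rw [Finset.sum_comm]
      _ ≤ ∑ x, ∑ x', (if zf x = zf x' then 1 else 0) * K x x' := by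
          gcongr with x _ x' _
          · exact hK0 x x'
          · exact hcoll x x'
      _ = ∑ x', ∑ x with zf x = zf x', K x x' := by
          rw [Finset.sum_comm]
          refine Finset.sum_congr rfl fun x' _ => ?_
          rw [Finset.sum_filter]
          refine Finset.sum_congr rfl fun x _ => by split_ifs <;> simp
      _ ≤ ∑ x', lam * ‖v x'‖ ^ 2 := by
          refine Finset.sum_le_sum fun x' _ => ?_
          obtain ⟨e, he1, he2⟩ := hK2 x'
          simp_rw [he1]
          rw [← he2]
          exact hv _ e
      _ = lam * S := by rw [← Finset.mul_sum]
  have hQ0 : ∀ f y, 0 ≤ Q f y := fun f y => hKc (c f y)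
  calc distFromIdeal h (fun z => ∑ x with zf x = z, InnerProductSpace.rankOne ℂ (v x) (v x))
      ≤ ∑ f, h f * ∑ y, ENNReal.ofReal (√(Q f y) * √S) := by
        refine Finset.sum_le_sum fun f _ => ?_
        gcongr with y
        rw [hop]
        exact hK1 (c f y)
    _ = ENNReal.ofReal (∑ f, p f * ∑ y, √(Q f y) * √S) := by
        rw [ENNReal.ofReal_sum_of_nonneg fun f _ => mul_nonneg (hp0 f) (by positivity)]
        refine Finset.sum_congr rfl fun f _ => ?_
        rw [ENNReal.ofReal_mul (hp0 f), ← hpf,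
          ENNReal.ofReal_sum_of_nonneg fun y _ => by positivity]
    _ ≤ _ := by
        refine ENNReal.ofReal_le_ofReal ?_
        have h1 : ∑ f, p f * ∑ y, √(Q f y) * √S
            = (∑ q : (Z → Fin l → Fin 2) × (Fin l → Fin 2),
                √(p q.1) * (√(p q.1) * √(Q q.1 q.2))) * √S := by
          rw [Fintype.sum_prod_type, Finset.sum_mul]
          refine Finset.sum_congr rfl fun f _ => ?_
          rw [Finset.mul_sum, Finset.sum_mul]
          refine Finset.sum_congr rfl fun y _ => ?_
          rw [← mul_assoc, ← mul_assoc √(p f), Real.mul_self_sqrt (hp0 f)]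
        -- Cauchy–Schwarz over hash and output with weights `p`; the $2^l$ outputs produce the
        -- factor $\sqrt{2^l}$.
        have h2 : ∑ q : (Z → Fin l → Fin 2) × (Fin l → Fin 2), √(p q.1) * (√(p q.1) * √(Q q.1 q.2))
            ≤ √(2 ^ l) * √(lam * S) := by
          refine (Real.sum_mul_le_sqrt_mul_sqrt _ _ _).trans ?_
          gcongr
          · rw [Fintype.sum_prod_type]
            simp_rw [Real.sq_sqrt (hp0 _), Finset.sum_const, Finset.card_univ, Fintype.card_fun,
              Fintype.card_fin]
            rw [← Finset.smul_sum, hp1]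
            simp
          · rw [Fintype.sum_prod_type]
            simp_rw [mul_pow, Real.sq_sqrt (hp0 _), Real.sq_sqrt (hQ0 _ _)]
            exact hQ
        rw [h1]
        refine (mul_le_mul_of_nonneg_right h2 (Real.sqrt_nonneg S)).trans (le_of_eq ?_)
        rw [Real.sqrt_mul hlam, Real.sqrt_mul (by positivity), mul_assoc, mul_assoc, mul_assoc,
          Real.mul_self_sqrt hS0]

end LeftoverHash

/-! ### Sampling without replacement. -/

section Sampling

open MeasureTheory ProbabilityTheory

/-- Hoeffding's lemma for a uniformly chosen element of `T`. -/
theorem sum_exp_sub_mean_le {ι : Type*} [Fintype ι] (T : Finset ι) (hT : T.Nonempty)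
    (x : ι → ℝ) (hx : ∀ i, x i ∈ Set.Icc (0 : ℝ) 1) (c : ℝ) :
    ∑ i ∈ T, Real.exp (c * (x i - (∑ j ∈ T, x j) / T.card))
      ≤ T.card * Real.exp (c ^ 2 / 8) := by
  classical
  let _ : MeasurableSpace ι := ⊤
  let ν := (PMF.uniformOfFinset T hT).toMeasure
  have hcard : (0 : ℝ) < T.card := by exact_mod_cast hT.card_pos
  have hint : ∀ f : ι → ℝ, ∫ i, f i ∂ν = (∑ i ∈ T, f i) / T.card := by
    intro f
    rw [PMF.integral_eq_sum, Finset.sum_div, ← Finset.sum_subset (Finset.subset_univ T)]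
    · refine Finset.sum_congr rfl fun i hi => ?_
      rw [PMF.uniformOfFinset_apply_of_mem hT hi]
      simp [div_eq_inv_mul]
    · intro i _ hi
      rw [PMF.uniformOfFinset_apply_of_notMem hT hi]
      simp
  have hsub := hasSubgaussianMGF_of_mem_Icc (X := x) (μ := ν) (a := 0) (b := 1)
    (measurable_from_top.aemeasurable) (Filter.Eventually.of_forall hx)
  have := hsub.mgf_le c
  rw [mgf, hint, hint, div_le_iff₀ hcard] at this
  refine this.trans (le_of_eq ?_)
  rw [mul_comm]
  congr 2
  norm_num
  ring

/-- Double counting of a set of size $k+1$ with a marked element, equivalently a set of size $k$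
with a further point. -/
theorem sum_powersetCard_succ {ι : Type*} [Fintype ι] [DecidableEq ι] (k : ℕ)
    (F : Finset ι → ℝ) :
    (k + 1) * ∑ s ∈ Finset.powersetCard (k + 1) Finset.univ, F s
      = ∑ s ∈ Finset.powersetCard k Finset.univ, ∑ i ∈ sᶜ, F (insert i s) := by
  have h1 : (k + 1 : ℝ) * ∑ s ∈ Finset.powersetCard (k + 1) (Finset.univ : Finset ι), F s
      = ∑ s ∈ Finset.powersetCard (k + 1) (Finset.univ : Finset ι), ∑ i ∈ s, F s := by
    rw [Finset.mul_sum]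
    refine Finset.sum_congr rfl fun s hs => ?_
    rw [Finset.sum_const, (Finset.mem_powersetCard.1 hs).2, nsmul_eq_mul]
    push_cast
    rfl
  rw [h1, Finset.sum_sigma', Finset.sum_sigma']
  refine Finset.sum_bij' (fun p _ => ⟨p.1.erase p.2, p.2⟩) (fun p _ => ⟨insert p.2 p.1, p.2⟩)
    ?_ ?_ ?_ ?_ ?_
  · rintro ⟨s, i⟩ h
    simp only [Finset.mem_sigma, Finset.mem_powersetCard, Finset.subset_univ, true_and] at h
    simp [Finset.card_erase_of_mem h.2, h.1]
  · rintro ⟨s, i⟩ h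
    simp only [Finset.mem_sigma, Finset.mem_powersetCard, Finset.subset_univ, true_and,
      Finset.mem_compl] at h
    simp [Finset.card_insert_of_notMem h.2, h.1]
  · rintro ⟨s, i⟩ h
    simp only [Finset.mem_sigma] at h
    simp [Finset.insert_erase h.2]
  · rintro ⟨s, i⟩ h
    simp only [Finset.mem_sigma, Finset.mem_compl] at h
    simp [Finset.erase_insert h.2]
  · rintro ⟨s, i⟩ h
    simp only [Finset.mem_sigma] at h
    simp [Finset.insert_erase h.2]

/-- Serfling's bound on the moment generating function of sampling without replacement. -/
theorem sum_exp_sampling_le {N : ℕ} (x : Fin N → ℝ) (hx : ∀ i, x i ∈ Set.Icc (0 : ℝ) 1)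
    (c : ℝ) (k : ℕ) (hk : k < N) :
    ∑ s ∈ Finset.powersetCard k (Finset.univ : Finset (Fin N)),
        Real.exp (c * ((∑ i ∈ s, x i - k * ((∑ i, x i) / N)) / (N - k)))
      ≤ N.choose k * Real.exp (c ^ 2 / 8 * ∑ j ∈ Finset.range k, 1 / ((N : ℝ) - 1 - j) ^ 2) := by
  induction k with
  | zero => simp
  | succ k ih =>
    have ih := ih (by omega)
    have hk1 : (0 : ℝ) < N - (k + 1) := by
      have : ((k + 1 : ℕ) : ℝ) < N := by exact_mod_cast hk
      push_cast at this; linarith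
    have hk0 : (0 : ℝ) < N - k := by linarith
    have hN : (0 : ℝ) < N := by exact_mod_cast (by omega : 0 < N)
    set p := (∑ i, x i) / N with hp
    set V := ∑ j ∈ Finset.range k, 1 / ((N : ℝ) - 1 - j) ^ 2 with hV
    have hrec := sum_powersetCard_succ (ι := Fin N) k
      (fun s => Real.exp (c * ((∑ i ∈ s, x i - (k + 1 : ℕ) * p) / (N - (k + 1 : ℕ)))))
    -- The centred sum divided by $N-k$ is a martingale: drawing $i$ adds $x_i$ minus the mean over
    -- the undrawn elements, divided by $N-k-1$. Hoeffding's lemma is applied with that scaling of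
    -- `c`.
    have hstep : ∀ s ∈ Finset.powersetCard k (Finset.univ : Finset (Fin N)),
        ∑ i ∈ sᶜ, Real.exp (c * ((∑ j ∈ insert i s, x j - (k + 1 : ℕ) * p) / (N - (k + 1 : ℕ))))
        ≤ Real.exp (c * ((∑ i ∈ s, x i - k * p) / (N - k)))
          * ((N - k) * Real.exp (c ^ 2 / 8 * (1 / ((N : ℝ) - 1 - k) ^ 2))) := by
      intro s hs
      have hcard : s.card = k := (Finset.mem_powersetCard.1 hs).2
      have hcc : ((sᶜ).card : ℝ) = N - k := by
        rw [Finset.card_compl, Fintype.card_fin, hcard, Nat.cast_sub (by omega)]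
      have hne : (sᶜ).Nonempty := by
        rw [← Finset.card_pos, Finset.card_compl, Fintype.card_fin, hcard]; omega
      have hmean : ∑ j ∈ sᶜ, x j = N * p - ∑ j ∈ s, x j := by
        rw [hp, mul_div_cancel₀ _ hN.ne', ← Finset.sum_add_sum_compl s]; ring
      have hH := sum_exp_sub_mean_le sᶜ hne x hx (c / (N - (k + 1)))
      rw [hcc, hmean] at hH
      have hexp : c ^ 2 / 8 * (1 / ((N : ℝ) - 1 - k) ^ 2) = (c / (N - (k + 1))) ^ 2 / 8 := by
        rw [show (N : ℝ) - 1 - k = N - (k + 1) by ring]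
        field_simp
      rw [hexp]
      refine le_trans (le_of_eq ?_) (mul_le_mul_of_nonneg_left hH (Real.exp_nonneg _))
      rw [Finset.mul_sum]
      refine Finset.sum_congr rfl fun i hi => ?_
      rw [← Real.exp_add, Finset.sum_insert (Finset.mem_compl.1 hi)]
      congr 1
      push_cast
      field_simp
      ring
    have hle := (Finset.sum_le_sum hstep)
    rw [← hrec, ← Finset.sum_mul] at hle
    have hle2 := hle.trans (mul_le_mul_of_nonneg_right ih (by positivity))
    have hch : (N.choose (k + 1) : ℝ) * (k + 1) = N.choose k * (N - k) := by
      have := Nat.choose_succ_right_eq N k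
      rw [← Nat.cast_sub (by omega : k ≤ N)]
      exact_mod_cast this
    rw [Finset.sum_range_succ, mul_add, Real.exp_add]
    have hk2 : (0 : ℝ) < k + 1 := by positivity
    refine le_of_mul_le_mul_left (hle2.trans (le_of_eq ?_)) hk2
    rw [← hV]
    linear_combination (-(Real.exp (c ^ 2 / 8 * V) *
      Real.exp (c ^ 2 / 8 * (1 / ((N : ℝ) - 1 - k) ^ 2)))) * hch

theorem sum_inv_sq_le (n m : ℕ) (hn : 0 < n) :
    ∑ j ∈ Finset.range m, 1 / ((n : ℝ) + m - 1 - j) ^ 2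
      ≤ (m : ℝ) * (n + 1) / ((n : ℝ) ^ 2 * (n + m)) := by
  have hn' : (0 : ℝ) < n := by exact_mod_cast hn
  have hrefl : ∑ j ∈ Finset.range m, 1 / ((n : ℝ) + m - 1 - j) ^ 2
      = ∑ j ∈ Finset.range m, 1 / ((n : ℝ) + j) ^ 2 := by
    rw [← Finset.sum_range_reflect]
    refine Finset.sum_congr rfl fun j hj => ?_
    have : j + 1 ≤ m := Finset.mem_range.1 hj
    rw [Nat.sub_sub, Nat.cast_sub (by omega)]
    push_cast
    congr 2
    ring
  rw [hrefl]
  clear hrefl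
  induction m with
  | zero => simp
  | succ m ih =>
    rw [Finset.sum_range_succ]
    have hm : (0 : ℝ) ≤ m := Nat.cast_nonneg m
    -- The right side is exactly the increment of the claimed bound from $m$ to $m+1$.
    have : 1 / ((n : ℝ) + m) ^ 2 ≤ (n + 1) / (n * (n + m) * (n + m + 1)) := by
      rw [div_le_div_iff₀ (by positivity) (by positivity)]
      have : 0 ≤ ((n : ℝ) + m) * m := by positivity
      nlinarith
    refine (add_le_add ih this).trans (le_of_eq ?_)
    push_cast
    field_simp
    ring

theorem Sample.card_filter_pos {N m : ℕ} (t : Sample N m) (b : Fin N → Prop) [DecidablePred b] :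
    (Finset.univ.filter fun j => b (t.pos j)).card = (t.1.filter b).card := by
  rw [← Finset.card_map t.pos.toEmbedding]
  congr 1
  have h : Finset.univ.map t.pos.toEmbedding = t.1 := Finset.map_orderEmbOfFin_univ t.1 t.2
  conv_rhs => rw [← h]
  rw [Finset.filter_map]
  rfl

theorem Sample.card_filter_rest {N m : ℕ} (t : Sample N m) (b : Fin N → Prop)
    [DecidablePred b] :
    (Finset.univ.filter fun j => b (t.rest j)).card = ((t.1ᶜ).filter b).card := by
  rw [← Finset.card_map t.rest.toEmbedding]
  congr 1
  have h : Finset.univ.map t.rest.toEmbedding = t.1ᶜ := Finset.map_orderEmbOfFin_univ _ _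
  conv_rhs => rw [← h]
  rw [Finset.filter_map]
  rfl

/-- Chernoff's method on Serfling's bound. A bad sample contains too few marked points, so the
exponent is negative. -/
theorem card_bad_sample_le {N m : ℕ} (hm : 0 < m) (hmN : 2 * m ≤ N) {ε : ℝ} (hε : 0 < ε)
    (hε1 : ε ≤ 1) (b : Fin N → Prop) [DecidablePred b] :
    ((Finset.univ.filter fun t : Sample N m => ((N : ℝ) - m) *
        ((Finset.univ.filter fun j => b (t.pos j)).card / m + sampleError N m ε)
        < (Finset.univ.filter fun j => b (t.rest j)).card).card : ℝ) ≤ ε ^ 2 * N.choose m := by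
  have hm' : (0 : ℝ) < m := by exact_mod_cast hm
  have hN' : (0 : ℝ) < N := by exact_mod_cast (by omega : 0 < N)
  have hmN' : 2 * (m : ℝ) ≤ N := by exact_mod_cast hmN
  have hn' : (0 : ℝ) < N - m := by linarith
  set δ := sampleError N m ε with hδ
  set L := Real.log (2 / ε ^ 2) with hL
  have hL0 : 0 ≤ L := by
    apply Real.log_nonneg
    rw [le_div_iff₀ (by positivity)]
    nlinarith
  have hδ2 : δ ^ 2 = (N + 2) * L / (m * N) := Real.sq_sqrt (by positivity)
  have hδ0 : 0 ≤ δ := Real.sqrt_nonneg _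
  set x : Fin N → ℝ := fun i => if b i then 1 else 0 with hx
  have hx01 : ∀ i, x i ∈ Set.Icc (0 : ℝ) 1 := by
    intro i; simp only [hx]; split_ifs <;> simp
  -- `V` bounds the variance sum (here $2m\le N$ enters), `τ` is the martingale deviation forced by
  -- a bad sample, and $c=4\tau/V$ minimises $c^2V/8-c\tau$. The minimum is $-\ln(2/\varepsilon^2)$,
  -- which is what fixes $\delta$.
  set V : ℝ := 2 * m * (N + 2) / N ^ 3 with hV
  have hV0 : 0 < V := by positivity
  set τ : ℝ := δ * m / N with hτ
  set c : ℝ := 4 * τ / V with hc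
  have hc0 : 0 ≤ c := by positivity
  have hVle : ∑ j ∈ Finset.range m, 1 / ((N : ℝ) - 1 - j) ^ 2 ≤ V := by
    have h := sum_inv_sq_le (N - m) m (by omega)
    rw [Nat.cast_sub (by omega : m ≤ N), sub_add_cancel] at h
    refine h.trans ?_
    rw [hV, div_le_div_iff₀ (by positivity) (by positivity)]
    have hq : 0 ≤ (m : ℝ) * N * (N - 2 * m) := by
      have : (0 : ℝ) ≤ N - 2 * m := by linarith
      positivity
    have h2 : ((N : ℝ) - m + 1) * N ^ 2 ≤ 2 * (N + 2) * (N - m) ^ 2 := by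
      set n : ℝ := N - m with hn
      have h1 : (N : ℝ) ≤ 2 * n := by linarith
      nlinarith [mul_nonneg (mul_nonneg hn'.le hN'.le) (sub_nonneg.2 h1),
        mul_nonneg hn'.le (sub_nonneg.2 h1), mul_nonneg hN'.le (sub_nonneg.2 h1)]
    nlinarith [mul_le_mul_of_nonneg_left h2 (mul_nonneg hm'.le hN'.le)]
  have hmgf := sum_exp_sampling_le x hx01 (-c) m (by omega)
  have hexp : c ^ 2 / 8 * V - c * τ = -L := by
    have h1 : c ^ 2 / 8 * V - c * τ = -(2 * (δ ^ 2 * m ^ 2 / N ^ 2) / V) := by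
      rw [hc, hτ]; field_simp; ring
    rw [h1, hδ2, hV]
    field_simp
  have hbad : ((Finset.univ.filter fun t : Sample N m => ((N : ℝ) - m) *
        ((Finset.univ.filter fun j => b (t.pos j)).card / m + δ)
        < (Finset.univ.filter fun j => b (t.rest j)).card).card : ℝ) * Real.exp (c * τ)
      ≤ ∑ s ∈ Finset.powersetCard m (Finset.univ : Finset (Fin N)),
        Real.exp (-c * ((∑ i ∈ s, x i - m * ((∑ i, x i) / N)) / (N - m))) := by
    rw [Finset.sum_subtype (p := fun s : Finset (Fin N) => s.card = m) _
      (fun s => by simp [Finset.mem_powersetCard])]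
    rw [← nsmul_eq_mul, ← Finset.sum_const]
    refine (Finset.sum_le_sum fun t ht => ?_).trans
      (Finset.sum_le_sum_of_subset_of_nonneg (Finset.filter_subset _ _)
        fun t _ _ => Real.exp_nonneg _)
    have ht := (Finset.mem_filter.1 ht).2
    rw [Sample.card_filter_pos, Sample.card_filter_rest] at ht
    have hA : ∑ i ∈ t.1, x i = ((t.1.filter b).card : ℝ) := by simp [hx]
    have hB : ∑ i, x i = ((t.1.filter b).card : ℝ) + (((t.1ᶜ).filter b).card : ℝ) := by
      rw [← Finset.sum_add_sum_compl t.1]; simp [hx]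
    rw [hA, hB, Real.exp_le_exp]
    set A : ℝ := ((t.1.filter b).card : ℝ)
    set B : ℝ := (((t.1ᶜ).filter b).card : ℝ)
    rw [neg_mul, ← mul_neg]
    refine mul_le_mul_of_nonneg_left ?_ hc0
    have h1 : -((A - m * ((A + B) / N)) / (N - m)) = (m * B - (N - m) * A) / ((N - m) * N) := by
      field_simp; ring
    rw [h1, hτ, div_le_div_iff₀ hN' (by positivity)]
    have h2 : ((N : ℝ) - m) * (A + m * δ) ≤ m * B := by
      have := mul_le_mul_of_nonneg_left ht.le hm'.le
      refine le_trans (le_of_eq ?_) this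
      field_simp
    nlinarith [mul_le_mul_of_nonneg_right h2 hN'.le]
  have hfin := hbad.trans hmgf
  have h3 : Real.exp ((-c) ^ 2 / 8 * ∑ j ∈ Finset.range m, 1 / ((N : ℝ) - 1 - j) ^ 2)
      ≤ Real.exp (c * τ) * (ε ^ 2 / 2) := by
    have h4 : ε ^ 2 / 2 = Real.exp (-L) := by
      rw [Real.exp_neg, hL, Real.exp_log (by positivity), inv_div]
    rw [h4, ← Real.exp_add, Real.exp_le_exp, neg_sq, ← hexp]
    have := mul_le_mul_of_nonneg_left hVle (by positivity : 0 ≤ c ^ 2 / 8)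
    linarith
  have h5 := hfin.trans (mul_le_mul_of_nonneg_left h3 (Nat.cast_nonneg _))
  refine le_of_mul_le_mul_right (h5.trans ?_) (Real.exp_pos (c * τ))
  have : (0 : ℝ) ≤ N.choose m * Real.exp (c * τ) * (ε ^ 2 / 2) := by positivity
  nlinarith

end Sampling

/-! ### Size of Hamming balls. -/

section HammingBall

theorem sum_pow_weight (n : ℕ) {W : Type*} [Fintype W] [DecidableEq W] [Zero W] (r : ℝ) :
    ∑ i : Fin n → W, r ^ (Finset.univ.filter fun j => i j ≠ 0).card
      = (1 + (Fintype.card W - 1) * r) ^ n := by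
  have h1 : ∑ w : W, (if w ≠ 0 then r else 1) = 1 + (Fintype.card W - 1) * r := by
    rw [← Finset.add_sum_erase _ _ (Finset.mem_univ (0 : W)), if_neg (by simp),
      Finset.sum_congr rfl fun w hw => if_pos (Finset.ne_of_mem_erase hw), Finset.sum_const,
      Finset.card_erase_of_mem (Finset.mem_univ _), Finset.card_univ, nsmul_eq_mul,
      Nat.cast_sub Fintype.card_pos, Nat.cast_one]
  calc ∑ i : Fin n → W, r ^ (Finset.univ.filter fun j => i j ≠ 0).card
      = ∑ i : Fin n → W, ∏ j, (if i j ≠ 0 then r else 1) := by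
        refine Finset.sum_congr rfl fun i _ => ?_
        rw [Finset.prod_ite]; simp
    _ = ∏ _j : Fin n, ∑ w : W, (if w ≠ 0 then r else 1) := by
        rw [Finset.prod_univ_sum, Fintype.piFinset_univ]
    _ = _ := by rw [h1, Finset.prod_const, Finset.card_univ, Fintype.card_fin]

/-- Chernoff's method: each word of the ball has $r^{\text{weight}}\ge r^{n\alpha}$ when $r\le1$,
and the sum of $r^{\text{weight}}$ over all words factorises. -/
theorem card_hammingBall_le (n : ℕ) {W : Type*} [Fintype W] [DecidableEq W] [Zero W] {d : ℕ}
    (hW : Fintype.card W = d) (hd : 2 ≤ d) {α : ℝ} (hα : 0 < α) :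
    ((Finset.univ.filter fun i : Fin n → W =>
        ((Finset.univ.filter fun j => i j ≠ 0).card : ℝ) ≤ n * α).card : ℝ)
      ≤ (d : ℝ) ^ (n * extEntropy d α) := by
  have hd' : (2 : ℝ) ≤ d := by exact_mod_cast hd
  have hd0 : (0 : ℝ) < d := by linarith
  unfold extEntropy
  rw [if_neg (not_lt.2 hα.le)]
  split_ifs with h
  · have hinv : 0 < 1 / (d : ℝ) := by positivity
    have h1α : 0 < 1 - α := by linarith
    have hd1 : (0 : ℝ) < d - 1 := by linarith
    -- The optimal tilt; $r\le1$ is equivalent to $\alpha\le1-1/d$, the threshold in the extended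
    -- entropy.
    set r : ℝ := α / ((d - 1) * (1 - α)) with hr
    have hr0 : 0 < r := by positivity
    have hr1 : r ≤ 1 := by
      rw [hr, div_le_one (by positivity)]
      have : (1 / (d : ℝ)) * d = 1 := by field_simp
      nlinarith
    have hsum := sum_pow_weight n (W := W) r
    have hbase : 1 + ((Fintype.card W : ℝ) - 1) * r = (1 - α)⁻¹ := by
      rw [hW, hr]; field_simp; ring
    rw [hbase] at hsum
    have hle : ((Finset.univ.filter fun i : Fin n → W =>
        ((Finset.univ.filter fun j => i j ≠ 0).card : ℝ) ≤ n * α).card : ℝ) * r ^ (n * α)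
        ≤ ((1 - α)⁻¹) ^ n := by
      rw [← hsum, ← nsmul_eq_mul, ← Finset.sum_const]
      refine (Finset.sum_le_sum fun i hi => ?_).trans
        (Finset.sum_le_sum_of_subset_of_nonneg (Finset.filter_subset _ _)
          fun i _ _ => by positivity)
      rw [← Real.rpow_natCast]
      exact Real.rpow_le_rpow_of_exponent_ge hr0 hr1 (Finset.mem_filter.1 hi).2
    rw [← le_div_iff₀ (by positivity)] at hle
    refine hle.trans (le_of_eq ?_)
    have hlog : Real.log d ≠ 0 := (Real.log_pos (by linarith)).ne'
    rw [Real.rpow_def_of_pos hr0, Real.rpow_def_of_pos hd0, ← Real.exp_log (inv_pos.2 h1α),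
      ← Real.exp_nat_mul, ← Real.exp_sub, Real.log_inv, hr, Real.log_div hα.ne' (by positivity),
      Real.log_mul hd1.ne' h1α.ne']
    congr 1
    unfold entropy
    simp only [Real.logb]
    field_simp
    ring
  · have h1 : ((Finset.univ.filter fun i : Fin n → W =>
        ((Finset.univ.filter fun j => i j ≠ 0).card : ℝ) ≤ n * α).card : ℝ) ≤ (d : ℝ) ^ n := by
      have := Finset.card_filter_le (Finset.univ : Finset (Fin n → W)) fun i =>
        ((Finset.univ.filter fun j => i j ≠ 0).card : ℝ) ≤ n * α
      rw [Finset.card_univ, Fintype.card_fun, Fintype.card_fin, hW] at this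
      exact_mod_cast this
    rw [mul_one, Real.rpow_natCast]
    exact h1

end HammingBall

/-! ### Unitarity of the walk. -/

section HonestState

variable {P μ : ℕ} [NeZero P]

/-- The active coin split off from the position and the memory coins. -/
def splitActiveCoin (P μ : ℕ) : Walker P μ ≃ (ZMod P × (Fin μ → Fin 2)) × Fin 2 where
  toFun s := ((s.1, Fin.init s.2), s.2 (Fin.last μ))
  invFun p := (p.1.1, Fin.snoc (α := fun _ => Fin 2) p.1.2 p.2)
  left_inv s := by simp
  right_inv p := by simp

omit [NeZero P] in
open scoped Kronecker in
theorem onActiveCoin_eq (U : CoinOp) :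
    onActiveCoin P μ U = Matrix.submatrix
      ((1 : Matrix (ZMod P × (Fin μ → Fin 2)) (ZMod P × (Fin μ → Fin 2)) ℂ) ⊗ₖ U)
      (splitActiveCoin P μ) (splitActiveCoin P μ) := by
  ext s' s
  simp [onActiveCoin, splitActiveCoin, Matrix.one_apply, Prod.ext_iff]

theorem onActiveCoin_mem_unitary {U : CoinOp} (hU : U ∈ Matrix.unitaryGroup (Fin 2) ℂ) :
    onActiveCoin P μ U ∈ Matrix.unitaryGroup (Walker P μ) ℂ := by
  rw [Matrix.mem_unitaryGroup_iff', onActiveCoin_eq, Matrix.star_eq_conjTranspose,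
    Matrix.conjTranspose_submatrix, Matrix.submatrix_mul_equiv, Matrix.conjTranspose_kronecker,
    ← Matrix.mul_kronecker_mul, ← Matrix.star_eq_conjTranspose U,
    Matrix.mem_unitaryGroup_iff'.1 hU]
  simp

theorem basisMap_mem_unitary {g : Walker P μ → Walker P μ} (hg : Function.Injective g) :
    basisMap g ∈ Matrix.unitaryGroup (Walker P μ) ℂ := by
  rw [Matrix.mem_unitaryGroup_iff']
  ext a b
  simp [Matrix.mul_apply, basisMap, Matrix.one_apply, hg.eq_iff, apply_ite, eq_comm]

theorem shiftOp_mem_unitary : shiftOp P μ ∈ Matrix.unitaryGroup (Walker P μ) ℂ := by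
  refine basisMap_mem_unitary fun s s' h => ?_
  simp only [Prod.mk.injEq] at h
  obtain ⟨h1, h2⟩ := h
  rw [h2] at h1
  exact Prod.ext (add_right_cancel h1) h2

theorem memoryOp_mem_unitary : memoryOp P μ ∈ Matrix.unitaryGroup (Walker P μ) ℂ := by
  refine basisMap_mem_unitary fun s s' h => ?_
  simp only [Prod.mk.injEq] at h
  obtain ⟨h1, h2⟩ := h
  have h3 := Fin.cons_injective2 h2
  refine Prod.ext h1 ?_
  rw [← Fin.snoc_init_self s.2, ← Fin.snoc_init_self s'.2, h3.1, h3.2]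

theorem walkOp_mem_unitary {coin : CoinOp} (h : coin ∈ Matrix.unitaryGroup (Fin 2) ℂ) :
    walkOp P μ coin ∈ Matrix.unitaryGroup (Walker P μ) ℂ :=
  mul_mem (mul_mem memoryOp_mem_unitary shiftOp_mem_unitary) (onActiveCoin_mem_unitary h)

theorem hadamardCoin_mem_unitary : hadamardCoin ∈ Matrix.unitaryGroup (Fin 2) ℂ := by
  have h2 : (√2 : ℂ) * √2 = 2 := by
    rw [← Complex.ofReal_mul, Real.mul_self_sqrt (by norm_num)]; norm_num
  have h3 : (√2 : ℂ)⁻¹ * (√2 : ℂ)⁻¹ = 1 / 2 := by rw [← mul_inv, h2]; norm_num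
  rw [Matrix.mem_unitaryGroup_iff']
  ext i j
  fin_cases i <;> fin_cases j <;>
    simp [hadamardCoin, Matrix.mul_apply, Fin.sum_univ_two, Complex.conj_ofReal, h3] <;>
    norm_num

theorem flipCoins_mem_unitary {U : CoinOp} (h : U ∈ flipCoins) :
    U ∈ Matrix.unitaryGroup (Fin 2) ℂ := by
  have h2 : (√2 : ℂ) * √2 = 2 := by
    rw [← Complex.ofReal_mul, Real.mul_self_sqrt (by norm_num)]; norm_num
  have h3 : (√2 : ℂ)⁻¹ * (√2 : ℂ)⁻¹ = 1 / 2 := by rw [← mul_inv, h2]; norm_num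
  rcases h with rfl | rfl | rfl
  · exact one_mem _
  · exact hadamardCoin_mem_unitary
  · rw [Matrix.mem_unitaryGroup_iff]
    ext i j
    fin_cases i <;> fin_cases j <;>
      simp only [Matrix.mul_apply, Fin.sum_univ_two, Matrix.star_apply, Matrix.smul_apply,
        Matrix.of_apply, Matrix.cons_val', Matrix.cons_val_zero, Matrix.cons_val_one,
        Matrix.cons_val_fin_one, Fin.zero_eta, Fin.mk_one, Fin.isValue, RCLike.star_def, map_mul,
        map_neg, map_inv₀, map_one, smul_eq_mul, Complex.conj_I, Complex.conj_ofReal,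
        Matrix.one_apply]
    · rw [if_pos trivial]
      linear_combination 2 * h3
    · rw [if_neg (by decide)]
      ring
    · rw [if_neg (by decide)]
      ring
    · rw [if_pos trivial]
      linear_combination 2 * h3 - 2 * (√2 : ℂ)⁻¹ * (√2 : ℂ)⁻¹ * Complex.I_mul_I

theorem generalCoin_mem_unitary (θ φ : ℝ) :
    generalCoin θ φ ∈ Matrix.unitaryGroup (Fin 2) ℂ := by
  have h1 : Complex.exp (Complex.I * φ) * Complex.exp (-(Complex.I * φ)) = 1 := by
    rw [← Complex.exp_add]; simp
  have h2 : conj (Complex.exp (Complex.I * φ)) = Complex.exp (-(Complex.I * φ)) := by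
    rw [← Complex.exp_conj]; simp
  have h3 : conj (Complex.exp (-(Complex.I * φ))) = Complex.exp (Complex.I * φ) := by
    rw [← Complex.exp_conj]; simp
  have h4 : (Real.sin θ : ℂ) ^ 2 + (Real.cos θ : ℂ) ^ 2 = 1 := by
    exact_mod_cast Real.sin_sq_add_cos_sq θ
  rw [Matrix.mem_unitaryGroup_iff]
  ext i j
  fin_cases i <;> fin_cases j <;>
    simp only [generalCoin, Matrix.mul_apply, Fin.sum_univ_two, Matrix.star_apply,
      Matrix.of_apply, Matrix.cons_val', Matrix.cons_val_zero, Matrix.cons_val_one,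
      Matrix.cons_val_fin_one, Fin.zero_eta, Fin.mk_one, Fin.isValue, RCLike.star_def, map_mul,
      map_neg, h2, h3, Complex.conj_ofReal, Matrix.one_apply]
  · rw [if_pos trivial]
    linear_combination (Real.sin θ ^ 2 + Real.cos θ ^ 2 : ℂ) * h1 + h4
  · rw [if_neg (by decide)]
    ring
  · rw [if_neg (by decide)]
    ring
  · rw [if_pos trivial]
    linear_combination (Real.sin θ ^ 2 + Real.cos θ ^ 2 : ℂ) * h1 + h4

/-- The remaining columns of `U` complete the honest state to an orthonormal basis, the test basis.
Everything that follows sees the walk only through `U`. -/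
theorem honestState_eq_mulVec {times : Finset ℕ} {c : CoinFamily} {w : WalkSetting}
    (hw : w ∈ settings times c) :
    ∃ U ∈ Matrix.unitaryGroup (Walker P μ) ℂ, ∀ a, honestState P μ w a = U a 0 := by
  have hu : w.coin ∈ Matrix.unitaryGroup (Fin 2) ℂ ∧ w.flip ∈ Matrix.unitaryGroup (Fin 2) ℂ := by
    cases c with
    | hadamard =>
      obtain ⟨-, h1, h2⟩ := hw
      rw [h1, h2]
      exact ⟨hadamardCoin_mem_unitary, one_mem _⟩
    | general R =>
      obtain ⟨-, h1, g, g', -, -, h2⟩ := hw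
      rw [h2]
      exact ⟨generalCoin_mem_unitary _ _, flipCoins_mem_unitary h1⟩
  refine ⟨walkOp P μ w.coin ^ w.steps * onActiveCoin P μ w.flip,
    mul_mem (pow_mem (walkOp_mem_unitary hu.1) _) (onActiveCoin_mem_unitary hu.2), fun a => ?_⟩
  rw [honestState, Matrix.mulVec_mulVec, Matrix.mulVec_single_one]
  rfl

end HonestState

/-! ### Matrices acting on the walkers' factor of a joint vector. -/

section MatrixAction

variable {I W : Type*} [Fintype I] [DecidableEq I] [Fintype W] [DecidableEq W]
  {E : Type*} [NormedAddCommGroup E] [InnerProductSpace ℂ E]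

/-- The action of `G ⊗ I` on a vector `∑ i, |i⟩ ⊗ y i`. -/
noncomputable def matAct (G : Matrix I I ℂ) (y : I → E) (r : I) : E := ∑ i, G r i • y i

omit [DecidableEq I] in
theorem matAct_matAct (G H : Matrix I I ℂ) (y : I → E) :
    matAct G (matAct H y) = matAct (G * H) y := by
  funext r
  simp only [matAct, Matrix.mul_apply, Finset.smul_sum, Finset.sum_smul, smul_smul]
  rw [Finset.sum_comm]

theorem matAct_one (y : I → E) : matAct (1 : Matrix I I ℂ) y = y := by
  funext r
  simp [matAct, Matrix.one_apply]

theorem sum_norm_sq_matAct {G : Matrix I I ℂ} (hG : G ∈ Matrix.unitaryGroup I ℂ) (y : I → E) :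
    ∑ r, ‖matAct G y r‖ ^ 2 = ∑ i, ‖y i‖ ^ 2 := by
  apply Complex.ofReal_injective
  push_cast
  have h1 : ∀ z : E, ((‖z‖ : ℂ)) ^ 2 = inner ℂ z z := fun z => by
    rw [inner_self_eq_norm_sq_to_K]; simp
  have hGG : ∀ i k, ∑ r, conj (G r i) * G r k = if i = k then 1 else 0 := by
    intro i k
    have := congrFun (congrFun (Matrix.mem_unitaryGroup_iff'.1 hG) i) k
    rwa [Matrix.mul_apply, Matrix.one_apply] at this
  simp_rw [h1]
  calc ∑ r, inner ℂ (matAct G y r) (matAct G y r)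
      = ∑ r, ∑ i, ∑ k, conj (G r i) * G r k * inner ℂ (y i) (y k) := by
        refine Finset.sum_congr rfl fun r _ => ?_
        rw [matAct, sum_inner]
        refine Finset.sum_congr rfl fun i _ => ?_
        rw [inner_sum]
        refine Finset.sum_congr rfl fun k _ => ?_
        rw [inner_smul_left, inner_smul_right, mul_assoc]
    _ = ∑ i, ∑ k, (∑ r, conj (G r i) * G r k) * inner ℂ (y i) (y k) := by
        rw [Finset.sum_comm]
        refine Finset.sum_congr rfl fun i _ => ?_
        rw [Finset.sum_comm]
        refine Finset.sum_congr rfl fun k _ => ?_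
        rw [Finset.sum_mul]
    _ = ∑ i, inner ℂ (y i) (y i) := by
        simp [hGG]

/-- The tensor power of a matrix. -/
def tensorPow (U : Matrix W W ℂ) (n : ℕ) : Matrix (Fin n → W) (Fin n → W) ℂ :=
  Matrix.of fun r i => ∏ j, U (r j) (i j)

theorem tensorPow_mem_unitary {U : Matrix W W ℂ} (hU : U ∈ Matrix.unitaryGroup W ℂ) (n : ℕ) :
    tensorPow U n ∈ Matrix.unitaryGroup (Fin n → W) ℂ := by
  rw [Matrix.mem_unitaryGroup_iff']
  ext i k
  have hUU : ∀ a b, ∑ r, conj (U r a) * U r b = if a = b then 1 else 0 := by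
    intro a b
    have := congrFun (congrFun (Matrix.mem_unitaryGroup_iff'.1 hU) a) b
    rwa [Matrix.mul_apply, Matrix.one_apply] at this
  calc (star (tensorPow U n) * tensorPow U n) i k
      = ∑ r : Fin n → W, ∏ j, (conj (U (r j) (i j)) * U (r j) (k j)) := by
        rw [Matrix.mul_apply]
        refine Finset.sum_congr rfl fun r _ => ?_
        rw [Matrix.star_apply, tensorPow, Matrix.of_apply, Matrix.of_apply, Finset.prod_mul_distrib,
          RCLike.star_def, map_prod]
    _ = ∏ j, ∑ a, conj (U a (i j)) * U a (k j) := by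
        rw [Finset.prod_univ_sum, Fintype.piFinset_univ]
    _ = _ := by
        simp_rw [hUU]
        rw [Matrix.one_apply]
        split_ifs with h
        · simp [h]
        · obtain ⟨j, hj⟩ := Function.ne_iff.1 h
          exact Finset.prod_eq_zero (Finset.mem_univ j) (if_neg hj)

end MatrixAction

/-! ### Splitting words along the sample. -/

section Split

variable {N m : ℕ}

theorem Sample.sum_elim_bijective (t : Sample N m) :
    Function.Bijective (Sum.elim t.pos t.rest : Fin m ⊕ Fin (N - m) → Fin N) := by
  have h : (Sum.elim t.pos t.rest : Fin m ⊕ Fin (N - m) → Fin N)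
      = finSumEquivOfFinset t.2 (by rw [Finset.card_compl, t.2, Fintype.card_fin]) := by
    funext x
    cases x with
    | inl j => exact (finSumEquivOfFinset_inl _ _ j).symm
    | inr j => exact (finSumEquivOfFinset_inr _ _ j).symm
  rw [h]
  exact Equiv.bijective _

/-- The entries of a word on the sampled positions and on the others. -/
noncomputable def Sample.split (t : Sample N m) (W : Type*) :
    (Fin N → W) ≃ (Fin m → W) × (Fin (N - m) → W) :=
  (Equiv.arrowCongr (Equiv.ofBijective _ t.sum_elim_bijective).symm (Equiv.refl W)).trans
    (Equiv.sumArrowEquivProdArrow _ _ W)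

theorem Sample.split_symm_pos (t : Sample N m) {W : Type*} (p : Fin m → W)
    (r : Fin (N - m) → W) (j : Fin m) : (t.split W).symm (p, r) (t.pos j) = p j :=
  congrFun (congrArg Prod.fst ((t.split W).apply_symm_apply (p, r))) j

theorem Sample.split_symm_rest (t : Sample N m) {W : Type*} (p : Fin m → W)
    (r : Fin (N - m) → W) (j : Fin (N - m)) : (t.split W).symm (p, r) (t.rest j) = r j :=
  congrFun (congrArg Prod.snd ((t.split W).apply_symm_apply (p, r))) j

theorem Sample.prod_eq (t : Sample N m) (f : Fin N → ℂ) :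
    ∏ k, f k = (∏ j, f (t.pos j)) * ∏ j, f (t.rest j) := by
  rw [← (Equiv.ofBijective _ t.sum_elim_bijective).prod_comp, Fintype.prod_sum_type]
  rfl

end Split

/-! ### Test outcomes in the rotated basis. -/

section Rotation

variable {P μ : ℕ} [NeZero P] {N m : ℕ} {E : Type*} [NormedAddCommGroup E]
  [InnerProductSpace ℂ E]

/-- `s` is a label of the test basis for which the test has outcome `q`. -/
def Consistent (q : Fin m → Fin 2) (s : Fin m → Walker P μ) : Prop :=
  ∀ j, q j = 0 ↔ s j = 0

instance (q : Fin m → Fin 2) : DecidablePred (Consistent (P := P) (μ := μ) q) := fun s =>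
  inferInstanceAs (Decidable (∀ j, q j = 0 ↔ s j = 0))

theorem testOp_apply {w : WalkSetting} {U : WalkerOp P μ}
    (hU : U ∈ Matrix.unitaryGroup (Walker P μ) ℂ) (hw : ∀ a, honestState P μ w a = U a 0)
    (b : Fin 2) (x y : Walker P μ) :
    testOp P μ w b x y = ∑ s, (if (b = 0 ↔ s = 0) then 1 else 0) * (U x s * conj (U y s)) := by
  have h1 : ∑ s, U x s * conj (U y s) = (1 : WalkerOp P μ) x y := by
    have := congrFun (congrFun (Matrix.mem_unitaryGroup_iff.1 hU) x) y
    rwa [Matrix.mul_apply] at this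
  unfold testOp
  by_cases hb : b = 0
  · simp [hb, Matrix.vecMulVec_apply, hw]
  · have h2 : ∀ s, (if (b = 0 ↔ s = 0) then (1 : ℂ) else 0) * (U x s * conj (U y s))
        = U x s * conj (U y s) - if s = 0 then U x s * conj (U y s) else 0 := by
      intro s
      by_cases hs : s = 0 <;> simp [hb, hs]
    rw [Finset.sum_congr rfl fun s _ => h2 s, Finset.sum_sub_distrib, h1,
      Finset.sum_ite_eq' _ _ _, if_pos (Finset.mem_univ _)]
    simp only [hb, if_false, Matrix.sub_apply, Matrix.vecMulVec_apply, hw, Pi.star_apply,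
      RCLike.star_def]

/-- The components of a vector after the sampled walkers have been rotated by `U`. -/
noncomputable def rotateSample (U : WalkerOp P μ) (t : Sample N m) (ψ : JointVector P μ N E)
    (s : Fin m → Walker P μ) (r : Fin (N - m) → Walker P μ) : E :=
  matAct (star (tensorPow U m)) (fun p => ψ ((t.split _).symm (p, r))) s

/-- In the test basis on the sample and the computational basis elsewhere, the measured operator is
diagonal. A general sesquilinear `B` covers both the outcome probability (inner product) and the
adversary's state (rank-one operators). -/
theorem sum_tensorOp_diagonal {F : Type*} [AddCommGroup F] [Module ℂ F]
    (B : E →ₗ[ℂ] E →ₗ⋆[ℂ] F) {w : WalkSetting} {U : WalkerOp P μ}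
    (hU : U ∈ Matrix.unitaryGroup (Walker P μ) ℂ) (hw : ∀ a, honestState P μ w a = U a 0)
    (ψ : JointVector P μ N E) (t : Sample N m) (q : Fin m → Fin 2)
    (D : Fin (N - m) → Walker P μ → ℂ) :
    ∑ a, ∑ b, tensorOp t (fun j => testOp P μ w (q j)) (fun j => Matrix.diagonal (D j)) b a
        • B (ψ a) (ψ b)
      = ∑ s, ∑ r, (if Consistent q s then 1 else 0 : ℂ) • (∏ j, D j (r j)) •
        B (rotateSample U t ψ s r) (rotateSample U t ψ s r) := by
  have hT : ∀ p p' : Fin m → Walker P μ, ∏ j, testOp P μ w (q j) (p' j) (p j)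
      = ∑ s, (if Consistent q s then 1 else 0) *
        (tensorPow U m p' s * star (tensorPow U m) s p) := by
    intro p p'
    simp_rw [testOp_apply hU hw]
    rw [Finset.prod_univ_sum, Fintype.piFinset_univ]
    refine Finset.sum_congr rfl fun s _ => ?_
    rw [Finset.prod_mul_distrib, Finset.prod_mul_distrib, Matrix.star_apply, tensorPow,
      Matrix.of_apply, Matrix.of_apply, RCLike.star_def, map_prod, Finset.prod_boole]
    congr 1
    by_cases h : Consistent q s
    · rw [if_pos h, if_pos fun j _ => h j]
    · rw [if_neg h, if_neg fun h' => h fun j => h' j (Finset.mem_univ j)]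
  have hD : ∀ r r' : Fin (N - m) → Walker P μ,
      ∏ j, Matrix.diagonal (D j) (r' j) (r j) = if r' = r then ∏ j, D j (r j) else 0 := by
    intro r r'
    split_ifs with h
    · simp [h]
    · obtain ⟨j, hj⟩ := Function.ne_iff.1 h
      exact Finset.prod_eq_zero (Finset.mem_univ j) (Matrix.diagonal_apply_ne _ hj)
  have hB : ∀ s r, B (rotateSample U t ψ s r) (rotateSample U t ψ s r)
      = ∑ p, ∑ p', (tensorPow U m p' s * star (tensorPow U m) s p) •
        B (ψ ((t.split _).symm (p, r))) (ψ ((t.split _).symm (p', r))) := by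
    intro s r
    rw [rotateSample, matAct, LinearMap.map_sum₂]
    refine Finset.sum_congr rfl fun p _ => ?_
    rw [map_sum]
    refine Finset.sum_congr rfl fun p' _ => ?_
    rw [LinearMap.map_smulₛₗ, LinearMap.map_smul₂, smul_smul]
    congr 2
    rw [Matrix.star_apply, RCLike.star_def, Complex.conj_conj]
  rw [← (t.split (Walker P μ)).symm.sum_comp, Fintype.sum_prod_type_right]
  have hstep : ∀ r p, ∑ b, tensorOp t (fun j => testOp P μ w (q j))
        (fun j => Matrix.diagonal (D j)) b ((t.split _).symm (p, r))
        • B (ψ ((t.split _).symm (p, r))) (ψ b)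
      = ∑ p', ∑ s, ((if Consistent q s then 1 else 0 : ℂ) * (∏ j, D j (r j)) *
        (tensorPow U m p' s * star (tensorPow U m) s p)) •
          B (ψ ((t.split _).symm (p, r))) (ψ ((t.split _).symm (p', r))) := by
    intro r p
    rw [← (t.split (Walker P μ)).symm.sum_comp, Fintype.sum_prod_type]
    refine Finset.sum_congr rfl fun p' _ => ?_
    simp only [tensorOp, Matrix.of_apply, Sample.split_symm_pos, Sample.split_symm_rest, hD]
    simp only [mul_ite, mul_zero, ite_smul, zero_smul, Finset.sum_ite_eq',
      Finset.mem_univ, if_true]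
    rw [hT, Finset.sum_mul, Finset.sum_smul]
    refine Finset.sum_congr rfl fun s _ => ?_
    congr 1
    ring
  simp_rw [hstep, hB, Finset.smul_sum, smul_smul]
  rw [Finset.sum_comm (s := (Finset.univ : Finset (Fin m → Walker P μ)))
    (t := (Finset.univ : Finset (Fin (N - m) → Walker P μ)))]
  refine Finset.sum_congr rfl fun r _ => ?_
  rw [Finset.sum_congr rfl fun p _ => Finset.sum_comm, Finset.sum_comm]
  simp only [mul_assoc]

end Rotation

/-! ### Real and ideal vectors, and the min-entropy of the ideal ones. -/

section RealAndIdeal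

variable {P μ : ℕ} [NeZero P] {N m : ℕ} {E : Type*} [NormedAddCommGroup E]
  [InnerProductSpace ℂ E] {O : Type} [DecidableEq O]

/-- The vectors whose projectors add up to the state after the test outcome `q`. -/
noncomputable def realVec (U : WalkerOp P μ) (t : Sample N m) (ψ : JointVector P μ N E)
    (q : Fin m → Fin 2) (x : (Fin m → Walker P μ) × (Fin (N - m) → Walker P μ)) : E :=
  if Consistent q x.1 then rotateSample U t ψ x.1 x.2 else 0

theorem testProb_eq {w : WalkSetting} {U : WalkerOp P μ}
    (hU : U ∈ Matrix.unitaryGroup (Walker P μ) ℂ) (hw : ∀ a, honestState P μ w a = U a 0)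
    (ψ : JointVector P μ N E) (t : Sample N m) (q : Fin m → Fin 2) :
    testProb w ψ t q = ∑ x, ‖realVec U t ψ q x‖ ^ 2 := by
  have h := sum_tensorOp_diagonal (innerₛₗ ℂ (E := E)).flip hU hw ψ t q fun _ _ => 1
  simp only [Matrix.diagonal_one, LinearMap.flip_apply, innerₛₗ_apply_apply, smul_eq_mul] at h
  unfold testProb expectation
  rw [h, Fintype.sum_prod_type, Complex.re_sum]
  refine Finset.sum_congr rfl fun s _ => ?_
  rw [Complex.re_sum]
  refine Finset.sum_congr rfl fun r _ => ?_
  unfold realVec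
  rw [inner_self_eq_norm_sq_to_K]
  split_ifs
  · simp [← Complex.ofReal_pow]
  · simp

theorem rawBlock_eq {w : WalkSetting} {U : WalkerOp P μ}
    (hU : U ∈ Matrix.unitaryGroup (Walker P μ) ℂ) (hw : ∀ a, honestState P μ w a = U a 0)
    (out : Walker P μ → O) (ψ : JointVector P μ N E) (t : Sample N m) (q : Fin m → Fin 2)
    (z : Fin (N - m) → O) :
    rawBlock out w ψ t q z = (((testProb w ψ t q)⁻¹ : ℝ) : ℂ) •
      ∑ x with (fun j => out (x.2 j)) = z,
        InnerProductSpace.rankOne ℂ (realVec U t ψ q x) (realVec U t ψ q x) := by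
  let B : E →ₗ[ℂ] E →ₗ⋆[ℂ] (E →L[ℂ] E) :=
    LinearMap.mk₂'ₛₗ (RingHom.id ℂ) (starRingEnd ℂ) (fun x y => InnerProductSpace.rankOne ℂ x y)
      (by simp) (by simp) (by simp) (by simp)
  have h := sum_tensorOp_diagonal B hU hw ψ t q
    fun j s => if out s = z j then 1 else 0
  unfold rawBlock reducedOp extractOp
  congr 1
  refine h.trans ?_
  rw [Finset.sum_filter, Fintype.sum_prod_type]
  refine Finset.sum_congr rfl fun s _ => Finset.sum_congr rfl fun r _ => ?_
  rw [Fintype.prod_boole]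
  simp only [realVec, funext_iff]
  by_cases h1 : Consistent q s
  · by_cases h2 : ∀ j, out (r j) = z j
    · rw [if_pos h1, if_pos h1, if_pos h2, if_pos h2, one_smul, one_smul]; rfl
    · rw [if_neg h2, if_neg h2, zero_smul, smul_zero]
  · simp [if_neg h1]

/-- The part of `realVec` that is spanned by the words of the test basis in `J`. -/
noncomputable def idealVec (U : WalkerOp P μ) (t : Sample N m) (ψ : JointVector P μ N E)
    (q : Fin m → Fin 2) (J : Finset (Fin (N - m) → Walker P μ))
    (x : (Fin m → Walker P μ) × (Fin (N - m) → Walker P μ)) : E :=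
  if Consistent q x.1 then matAct (tensorPow U (N - m)) (fun i =>
    if i ∈ J then matAct (star (tensorPow U (N - m))) (rotateSample U t ψ x.1) i else 0) x.2
  else 0

/-- Rotating the sample and then the rest rotates all walkers, so the components do not depend on
`t` beyond relabelling. This permits averaging over samples one word at a time. -/
theorem matAct_rotateSample (U : WalkerOp P μ) (t : Sample N m) (ψ : JointVector P μ N E)
    (s : Fin m → Walker P μ) (i : Fin (N - m) → Walker P μ) :
    matAct (star (tensorPow U (N - m))) (rotateSample U t ψ s) i
      = matAct (star (tensorPow U N)) ψ ((t.split _).symm (s, i)) := by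
  unfold rotateSample matAct
  rw [← (t.split (Walker P μ)).symm.sum_comp, Fintype.sum_prod_type_right]
  refine Finset.sum_congr rfl fun r _ => ?_
  rw [Finset.smul_sum]
  refine Finset.sum_congr rfl fun p _ => ?_
  rw [smul_smul]
  congr 1
  simp only [Matrix.star_apply, tensorPow, Matrix.of_apply, t.prod_eq, Sample.split_symm_pos,
    Sample.split_symm_rest, star_mul']
  rw [mul_comm]

theorem rotateSample_eq_matAct {U : WalkerOp P μ}
    (hU : U ∈ Matrix.unitaryGroup (Walker P μ) ℂ) (t : Sample N m) (ψ : JointVector P μ N E)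
    (s : Fin m → Walker P μ) :
    rotateSample U t ψ s = matAct (tensorPow U (N - m))
      (matAct (star (tensorPow U (N - m))) (rotateSample U t ψ s)) := by
  rw [matAct_matAct, Matrix.mem_unitaryGroup_iff.1 (tensorPow_mem_unitary hU _), matAct_one]

theorem matAct_sub {I : Type*} [Fintype I] (G : Matrix I I ℂ) (y z : I → E) (r : I) :
    matAct G y r - matAct G z r = matAct G (fun i => y i - z i) r := by
  simp [matAct, smul_sub, Finset.sum_sub_distrib]

theorem inner_matAct {I : Type*} [Fintype I] (G : Matrix I I ℂ) (y : I → E) (r : I) (e : E) :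
    inner ℂ e (matAct G y r) = matAct G (fun i => inner ℂ e (y i)) r := by
  rw [matAct, matAct, inner_sum]
  simp only [inner_smul_right, smul_eq_mul]

/-- Rotating the rest back by a unitary preserves norms, so the error is the total weight of the
deleted words. -/
theorem sum_norm_sq_realVec_sub_idealVec {U : WalkerOp P μ}
    (hU : U ∈ Matrix.unitaryGroup (Walker P μ) ℂ) (t : Sample N m) (ψ : JointVector P μ N E)
    (q : Fin m → Fin 2) (J : Finset (Fin (N - m) → Walker P μ)) :
    ∑ x, ‖realVec U t ψ q x - idealVec U t ψ q J x‖ ^ 2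
      = ∑ x : (Fin m → Walker P μ) × (Fin (N - m) → Walker P μ),
        if Consistent q x.1 ∧ x.2 ∉ J then
          ‖matAct (star (tensorPow U N)) ψ ((t.split _).symm x)‖ ^ 2 else 0 := by
  rw [Fintype.sum_prod_type, Fintype.sum_prod_type]
  refine Finset.sum_congr rfl fun s _ => ?_
  unfold realVec idealVec
  by_cases h : Consistent q s
  · simp only [h, if_true, true_and]
    conv_lhs =>
      enter [2, r, 1, 1, 1]
      rw [rotateSample_eq_matAct hU]
    simp_rw [matAct_sub]
    rw [sum_norm_sq_matAct (tensorPow_mem_unitary hU _)]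
    refine Finset.sum_congr rfl fun i _ => ?_
    by_cases hi : i ∈ J
    · simp [hi]
    · simp [hi, matAct_rotateSample]
  · simp [h]

theorem sum_norm_sq_idealVec_le {U : WalkerOp P μ}
    (hU : U ∈ Matrix.unitaryGroup (Walker P μ) ℂ) (t : Sample N m) (ψ : JointVector P μ N E)
    (q : Fin m → Fin 2) (J : Finset (Fin (N - m) → Walker P μ)) :
    ∑ x, ‖idealVec U t ψ q J x‖ ^ 2 ≤ ∑ x, ‖realVec U t ψ q x‖ ^ 2 := by
  rw [Fintype.sum_prod_type, Fintype.sum_prod_type]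
  refine Finset.sum_le_sum fun s _ => ?_
  unfold realVec idealVec
  by_cases h : Consistent q s
  · simp only [h, if_true]
    conv_rhs => rw [rotateSample_eq_matAct hU]
    rw [sum_norm_sq_matAct (tensorPow_mem_unitary hU _),
      sum_norm_sq_matAct (tensorPow_mem_unitary hU _)]
    refine Finset.sum_le_sum fun i _ => ?_
    split_ifs
    · exact le_rfl
    · simp
  · simp [h]

/-- For one word the outcomes are independent: each letter `0` contributes at most `G`, every other
letter at most 1. -/
theorem sum_tensorPow_le {U : WalkerOp P μ} (hU : U ∈ Matrix.unitaryGroup (Walker P μ) ℂ)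
    (out : Walker P μ → O) {G : ℝ}
    (hG : ∀ o, ∑ a with out a = o, ‖U a 0‖ ^ 2 ≤ G) (n : ℕ) (i : Fin n → Walker P μ)
    (z : Fin n → O) :
    ∑ r with (fun j => out (r j)) = z, ‖tensorPow U n r i‖ ^ 2
      ≤ G ^ (Finset.univ.filter fun j => i j = 0).card := by
  have hset : (Finset.univ.filter fun r : Fin n → Walker P μ => (fun j => out (r j)) = z)
      = Fintype.piFinset fun j => Finset.univ.filter fun a => out a = z j := by
    ext r; simp [funext_iff]
  have hcol : ∀ s, ∑ a, ‖U a s‖ ^ 2 = 1 := by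
    intro s
    have := congrFun (congrFun (Matrix.mem_unitaryGroup_iff'.1 hU) s) s
    rw [Matrix.mul_apply, Matrix.one_apply_eq] at this
    apply Complex.ofReal_injective
    rw [Complex.ofReal_one, ← this]
    push_cast
    exact Finset.sum_congr rfl fun a _ => by
      rw [Matrix.star_apply, RCLike.star_def, Complex.conj_mul']
  calc ∑ r with (fun j => out (r j)) = z, ‖tensorPow U n r i‖ ^ 2
      = ∏ j, ∑ a with out a = z j, ‖U a (i j)‖ ^ 2 := by
        rw [Finset.prod_univ_sum, hset]
        refine Finset.sum_congr rfl fun r _ => ?_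
        rw [tensorPow, Matrix.of_apply, norm_prod, Finset.prod_pow]
    _ ≤ ∏ j, if i j = 0 then G else 1 := by
        refine Finset.prod_le_prod (fun j _ => by positivity) fun j _ => ?_
        split_ifs with h
        · rw [h]; exact hG _
        · rw [← hcol (i j)]
          exact Finset.sum_le_sum_of_subset_of_nonneg (Finset.filter_subset _ _)
            fun a _ _ => by positivity
    _ = _ := by rw [Finset.prod_ite]; simp

/-- The min-entropy of a superposition of few words of the test basis. -/
theorem idealVec_min_entropy {U : WalkerOp P μ} (hU : U ∈ Matrix.unitaryGroup (Walker P μ) ℂ)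
    (out : Walker P μ → O) {b : ℝ} (t : Sample N m)
    (ψ : JointVector P μ N E) (q : Fin m → Fin 2) (J : Finset (Fin (N - m) → Walker P μ))
    (hJ : ∀ i ∈ J, ∀ z : Fin (N - m) → O,
      ∑ r with (fun j => out (r j)) = z, ‖tensorPow U (N - m) r i‖ ^ 2 ≤ b)
    (z : Fin (N - m) → O) (e : E) :
    ∑ x with (fun j => out (x.2 j)) = z, ‖inner ℂ e (idealVec U t ψ q J x)‖ ^ 2
      ≤ J.card * b * ∑ x, ‖inner ℂ e (idealVec U t ψ q J x)‖ ^ 2 := by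
  rw [Finset.sum_filter, Fintype.sum_prod_type, Fintype.sum_prod_type, Finset.mul_sum]
  refine Finset.sum_le_sum fun s _ => ?_
  unfold idealVec
  by_cases h : Consistent q s
  · simp only [h, if_true, inner_matAct]
    rw [sum_norm_sq_matAct (tensorPow_mem_unitary hU _), ← Finset.sum_filter]
    set u : (Fin (N - m) → Walker P μ) → ℂ := fun i =>
      inner ℂ e (matAct (star (tensorPow U (N - m))) (rotateSample U t ψ s) i) with hu
    have hmat : ∀ r, matAct (tensorPow U (N - m)) (fun i => inner ℂ e
        (if i ∈ J then matAct (star (tensorPow U (N - m))) (rotateSample U t ψ s) i else 0)) r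
        = ∑ i ∈ J, tensorPow U (N - m) r i * u i := by
      intro r
      unfold matAct
      rw [← Finset.sum_subset (Finset.subset_univ J)]
      · exact Finset.sum_congr rfl fun i hi => by simp only [hi, if_true, smul_eq_mul]; rfl
      · intro i _ hi
        simp [hi]
    have hnorm : ∑ i, ‖inner ℂ e (if i ∈ J then
        matAct (star (tensorPow U (N - m))) (rotateSample U t ψ s) i else 0)‖ ^ 2
        = ∑ i ∈ J, ‖u i‖ ^ 2 := by
      rw [← Finset.sum_subset (Finset.subset_univ J)]
      · exact Finset.sum_congr rfl fun i hi => by rw [if_pos hi]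
      · intro i _ hi
        simp [hi]
    rw [hnorm]
    calc _ = ∑ r with (fun j => out (r j)) = z, ‖∑ i ∈ J, tensorPow U (N - m) r i * u i‖ ^ 2 :=
          Finset.sum_congr rfl fun r _ => by rw [hmat]
      _ ≤ ∑ r with (fun j => out (r j)) = z,
          J.card * ∑ i ∈ J, ‖tensorPow U (N - m) r i‖ ^ 2 * ‖u i‖ ^ 2 := by
          refine Finset.sum_le_sum fun r _ => ?_
          -- Cauchy–Schwarz over `J`: interference between the words costs at most the factor
          -- `J.card`.
          refine (pow_le_pow_left₀ (norm_nonneg _) (norm_sum_le _ _) 2).trans ?_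
          refine sq_sum_le_card_mul_sum_sq.trans (le_of_eq ?_)
          simp_rw [norm_mul, mul_pow]
      _ = J.card * ∑ i ∈ J, (∑ r with (fun j => out (r j)) = z,
            ‖tensorPow U (N - m) r i‖ ^ 2) * ‖u i‖ ^ 2 := by
          rw [← Finset.mul_sum, Finset.sum_comm]
          simp_rw [Finset.sum_mul]
      _ ≤ J.card * ∑ i ∈ J, b * ‖u i‖ ^ 2 := by
          gcongr with i hi
          exact hJ i hi z
      _ = _ := by rw [← Finset.mul_sum, mul_assoc]
  · simp [h]

end RealAndIdeal

/-! ### Security for a fixed outcome, and the average error. -/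

section Security

variable {P μ : ℕ} [NeZero P] {N m : ℕ} {E : Type*} [NormedAddCommGroup E]
  [InnerProductSpace ℂ E] {O : Type} [Fintype O] [DecidableEq O]

/-- Triangle inequality through the ideal vectors. The unnormalised states differ by at most
$2\sqrt{pe}$ in trace norm; `distFromIdeal_le_add` doubles this and normalisation divides by $p$,
giving $4\sqrt{e/p}$. -/
theorem distFromIdeal_rawBlock_le {w : WalkSetting} {U : WalkerOp P μ}
    (hU : U ∈ Matrix.unitaryGroup (Walker P μ) ℂ) (hw : ∀ a, honestState P μ w a = U a 0)
    (out : Walker P μ → O) (ψ : JointVector P μ N E) (t : Sample N m) (q : Fin m → Fin 2)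
    (hp : 0 < testProb w ψ t q) (J : Finset (Fin (N - m) → Walker P μ)) {b ε : ℝ}
    (hb : 0 ≤ b) (hε : 0 ≤ ε)
    (hJ : ∀ i ∈ J, ∀ z : Fin (N - m) → O,
      ∑ r with (fun j => out (r j)) = z, ‖tensorPow U (N - m) r i‖ ^ 2 ≤ b)
    {l : ℕ} (hl : 2 ^ l * (J.card * b) ≤ ε ^ 2)
    (h : PMF ((Fin (N - m) → O) → Fin l → Fin 2)) (hh : TwoUniversal h) :
    distFromIdeal h (rawBlock out w ψ t q) ≤ ENNReal.ofReal
      (ε + 4 * √((∑ x, ‖realVec U t ψ q x - idealVec U t ψ q J x‖ ^ 2) / testProb w ψ t q)) := by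
  set p := testProb w ψ t q with hpdef
  set v := realVec U t ψ q with hv
  set v' := idealVec U t ψ q J with hv'
  set e := ∑ x, ‖v x - v' x‖ ^ 2 with he
  have he0 : 0 ≤ e := by positivity
  have hpv : p = ∑ x, ‖v x‖ ^ 2 := testProb_eq hU hw ψ t q
  have hpv' : ∑ x, ‖v' x‖ ^ 2 ≤ p := hpv ▸ sum_norm_sq_idealVec_le hU t ψ q J
  let zf : (Fin m → Walker P μ) × (Fin (N - m) → Walker P μ) → Fin (N - m) → O :=
    fun x j => out (x.2 j)
  have hblock : rawBlock out w ψ t q = fun z => ((p⁻¹ : ℝ) : ℂ) •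
      ∑ x with zf x = z, InnerProductSpace.rankOne ℂ (v x) (v x) :=
    funext fun z => rawBlock_eq hU hw out ψ t q z
  have hideal := distFromIdeal_le_of_min_entropy h hh v' zf (lam := J.card * b) (by positivity)
    (idealVec_min_entropy hU out t ψ q J hJ)
  have hideal2 : √(2 ^ l * (J.card * b)) * ∑ x, ‖v' x‖ ^ 2 ≤ ε * p := by
    refine mul_le_mul ?_ hpv' (by positivity) hε
    exact (Real.sqrt_le_sqrt hl).trans (Real.sqrt_sq hε).le
  have hdiff : ∑ z, traceNorm ((∑ x with zf x = z, InnerProductSpace.rankOne ℂ (v x) (v x))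
      - ∑ x with zf x = z, InnerProductSpace.rankOne ℂ (v' x) (v' x))
      ≤ ENNReal.ofReal (2 * (√p * √e)) := by
    calc _ ≤ ∑ z, ∑ x with zf x = z, ENNReal.ofReal ((‖v x‖ + ‖v' x‖) * ‖v x - v' x‖) := by
          refine Finset.sum_le_sum fun z _ => ?_
          rw [← Finset.sum_sub_distrib]
          exact (traceNorm_sum_le _ _).trans
            (Finset.sum_le_sum fun x _ => traceNorm_rankOne_self_sub_le _ _)
      _ = ENNReal.ofReal (∑ x, (‖v x‖ + ‖v' x‖) * ‖v x - v' x‖) := by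
          rw [Finset.sum_fiberwise, ENNReal.ofReal_sum_of_nonneg fun x _ => by positivity]
      _ ≤ _ := by
          refine ENNReal.ofReal_le_ofReal ?_
          simp_rw [add_mul]
          rw [Finset.sum_add_distrib, two_mul]
          refine add_le_add ?_ ?_
          · rw [hpv]
            exact Real.sum_mul_le_sqrt_mul_sqrt _ _ _
          · refine (Real.sum_mul_le_sqrt_mul_sqrt _ _ _).trans ?_
            gcongr
  have hpc : ‖((p⁻¹ : ℝ) : ℂ)‖ₑ = ENNReal.ofReal p⁻¹ := by
    rw [← ofReal_norm, Complex.norm_real, Real.norm_of_nonneg (by positivity)]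
  rw [hblock]
  calc _ ≤ ENNReal.ofReal p⁻¹ * (ENNReal.ofReal (ε * p)
        + 2 * ENNReal.ofReal (2 * (√p * √e))) := by
        refine (distFromIdeal_smul_le h _ _).trans ?_
        rw [hpc]
        gcongr
        refine (distFromIdeal_le_add h _ _).trans (add_le_add
          (hideal.trans (ENNReal.ofReal_le_ofReal hideal2)) ?_)
        gcongr
    _ = _ := by
        rw [← ENNReal.ofReal_ofNat 2, ← ENNReal.ofReal_mul (by norm_num),
          ← ENNReal.ofReal_add (by positivity) (by positivity),
          ← ENNReal.ofReal_mul (by positivity)]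
        congr 1
        rw [Real.sqrt_div he0]
        have hs : √p * √p = p := Real.mul_self_sqrt hp.le
        have hs0 : √p ≠ 0 := (Real.sqrt_pos.2 hp).ne'
        field_simp
        linear_combination (4 * √e) * hs

omit [Fintype O] in
theorem honestProb_eq {w : WalkSetting} {U : WalkerOp P μ}
    (hw : ∀ a, honestState P μ w a = U a 0) (out : Walker P μ → O) (o : O) :
    honestProb out w o = ∑ a with out a = o, ‖U a 0‖ ^ 2 := by
  unfold honestProb extractOp
  rw [dotProduct, Complex.re_sum, Finset.sum_filter]
  refine Finset.sum_congr rfl fun a _ => ?_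
  rw [Matrix.mulVec_diagonal, Pi.star_apply, hw]
  split_ifs
  · rw [one_mul, RCLike.star_def, Complex.conj_mul', ← Complex.ofReal_pow, Complex.ofReal_re]
  · simp

theorem honestProb_le_maxProb (w : WalkSetting) (out : Walker P μ → O) (o : O) :
    honestProb out w o ≤ maxProb out w :=
  le_ciSup (Set.finite_range _).bddAbove o

theorem maxProb_pos {w : WalkSetting} {U : WalkerOp P μ}
    (hU : U ∈ Matrix.unitaryGroup (Walker P μ) ℂ) (hw : ∀ a, honestState P μ w a = U a 0)
    (out : Walker P μ → O) : 0 < maxProb out w := by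
  by_contra hcon
  have h1 : ∑ o, honestProb out w o = ∑ a, ‖U a 0‖ ^ 2 := by
    simp_rw [honestProb_eq hw]
    exact Finset.sum_fiberwise _ _ _
  have h2 : ∑ a, ‖U a 0‖ ^ 2 = 1 := by
    have := sum_norm_sq_matAct hU (Pi.single 0 (1 : ℂ))
    simpa [matAct, Pi.single_apply, apply_ite norm, ite_pow] using this
  have h3 : ∑ o, honestProb out w o ≤ 0 := Finset.sum_nonpos fun o _ =>
    (honestProb_le_maxProb w out o).trans (not_lt.1 hcon)
  linarith

omit [NeZero P] in
-- Each word of the test basis determines its test outcome, so exactly one term survives.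
theorem sum_consistent (s : Fin m → Walker P μ) (f : (Fin m → Fin 2) → ℝ) :
    ∑ q, (if Consistent q s then f q else 0) = f fun j => if s j = 0 then 0 else 1 := by
  rw [Finset.sum_eq_single (fun j => if s j = 0 then 0 else 1)]
  · rw [if_pos]
    intro j
    simp
  · intro q _ hq
    rw [if_neg]
    intro hc
    refine hq (funext fun j => ?_)
    have := hc j
    split_ifs with h
    · exact this.2 h
    · have h2 : q j ≠ 0 := fun h' => h (this.1 h')
      omega
  · simp

theorem sum_testProb {w : WalkSetting} {U : WalkerOp P μ}
    (hU : U ∈ Matrix.unitaryGroup (Walker P μ) ℂ) (hw : ∀ a, honestState P μ w a = U a 0)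
    (ψ : JointVector P μ N E) (t : Sample N m) :
    ∑ q : Fin m → Fin 2, testProb w ψ t q = ‖ψ‖ ^ 2 := by
  simp_rw [testProb_eq hU hw]
  rw [Finset.sum_comm, PiLp.norm_sq_eq_of_L2, ← (t.split (Walker P μ)).symm.sum_comp,
    Fintype.sum_prod_type_right, Fintype.sum_prod_type_right]
  refine Finset.sum_congr rfl fun r _ => ?_
  rw [← sum_norm_sq_matAct (Unitary.star_mem (tensorPow_mem_unitary hU m))
    (fun p => ψ ((t.split _).symm (p, r)))]
  refine Finset.sum_congr rfl fun s _ => ?_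
  have : ∀ q : Fin m → Fin 2, ‖realVec U t ψ q (s, r)‖ ^ 2
      = if Consistent q s then ‖rotateSample U t ψ s r‖ ^ 2 else 0 := by
    intro q
    unfold realVec
    split_ifs <;> simp
  simp_rw [this, sum_consistent]
  rfl

/-- The balance behind $\ell'$: output size, ball size and guessing probability multiply to exactly
$\varepsilon^2$, as the leftover hash lemma requires. -/
theorem two_rpow_stringLength_mul {d : ℕ} (hd : 2 ≤ d) {G ε : ℝ} (hG : 0 < G) (hε : 0 < ε)
    (q : Fin m → Fin 2) :
    (2 : ℝ) ^ stringLength d N m (-Real.logb 2 G) ε q *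
      ((d : ℝ) ^ (((N : ℝ) - m) * extEntropy d (relWeight q + sampleError N m ε))
        * G ^ etaQ N m ε q) = ε ^ 2 := by
  have hd' : (2 : ℝ) ≤ d := by exact_mod_cast hd
  have hlog : Real.log d ≠ 0 := (Real.log_pos (by linarith)).ne'
  have hlog2 : Real.log 2 ≠ 0 := (Real.log_pos (by norm_num)).ne'
  rw [Real.rpow_def_of_pos (by norm_num), Real.rpow_def_of_pos (by linarith),
    Real.rpow_def_of_pos hG, ← Real.exp_add, ← Real.exp_add]
  have h2 : ε ^ 2 = Real.exp (2 * Real.log ε) := by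
    rw [two_mul, Real.exp_add, Real.exp_log hε, sq]
  rw [h2]
  congr 1
  unfold stringLength
  rw [one_div, Real.logb_inv]
  simp only [Real.logb]
  field_simp
  ring

/-- With $x=\varepsilon^{1/3}$ this reads $x^3\le x^4+x^2+\tfrac14$, which holds because $x\le1$. -/
theorem ratio_le_rpow {ε : ℝ} (hε : 0 < ε) (hε1 : ε ≤ 1) :
    ε ^ 2 / (ε + ε ^ (1 / 3 : ℝ) / 2) ^ 2 ≤ ε ^ (1 / 3 : ℝ) := by
  set x := ε ^ (1 / 3 : ℝ) with hx
  have hx0 : 0 < x := Real.rpow_pos_of_pos hε _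
  have hx1 : x ≤ 1 := Real.rpow_le_one hε.le hε1 (by norm_num)
  have hx3 : ε = x ^ 3 := by
    rw [hx, ← Real.rpow_natCast, ← Real.rpow_mul hε.le]
    norm_num
  rw [hx3, div_le_iff₀ (by positivity)]
  have h1 : x ^ 3 ≤ x ^ 2 := pow_le_pow_of_le_one hx0.le hx1 (by norm_num)
  have h2 : 0 ≤ x ^ 4 := by positivity
  have h3 : 0 ≤ x ^ 3 * (x ^ 4 + x ^ 2 + 1 / 4 - x ^ 3) := by
    refine mul_nonneg (by positivity) ?_
    linarith
  nlinarith

/-- The words of the test basis outside the sample whose weight is compatible with `q`. -/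
noncomputable def lowWeight (P μ : ℕ) [NeZero P] (N : ℕ) (ε : ℝ) (q : Fin m → Fin 2) :
    Finset (Fin (N - m) → Walker P μ) :=
  Finset.univ.filter fun i => ((Finset.univ.filter fun j => i j ≠ 0).card : ℝ)
    ≤ ((N - m : ℕ) : ℝ) * (relWeight q + sampleError N m ε)

/-- After exchanging sums, each word is weighted by the number of samples misjudging it, and the
total weight of the words is $\|\psi\|^2$. -/
theorem sum_sum_error_le (hm : 0 < m) (hmN : 2 * m ≤ N) {ε : ℝ} (hε : 0 < ε) (hε1 : ε ≤ 1)
    {U : WalkerOp P μ} (hU : U ∈ Matrix.unitaryGroup (Walker P μ) ℂ) (ψ : JointVector P μ N E) :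
    ∑ t : Sample N m, ∑ q : Fin m → Fin 2,
        ∑ x, ‖realVec U t ψ q x - idealVec U t ψ q (lowWeight P μ N ε q) x‖ ^ 2
      ≤ ε ^ 2 * N.choose m * ‖ψ‖ ^ 2 := by
  set g : Walkers P μ N → ℝ := fun a => ‖matAct (star (tensorPow U N)) ψ a‖ ^ 2 with hg
  let bad : Sample N m → Walkers P μ N → Prop := fun t a => ((N : ℝ) - m) *
    ((Finset.univ.filter fun j => a (t.pos j) ≠ 0).card / m + sampleError N m ε)
    < (Finset.univ.filter fun j => a (t.rest j) ≠ 0).card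
  have hbad : ∀ t a, Decidable (bad t a) := fun t a => Classical.propDecidable _
  have h1 : ∀ t : Sample N m, ∑ q : Fin m → Fin 2,
      ∑ x, ‖realVec U t ψ q x - idealVec U t ψ q (lowWeight P μ N ε q) x‖ ^ 2
      = ∑ a, if bad t a then g a else 0 := by
    intro t
    simp_rw [sum_norm_sq_realVec_sub_idealVec hU]
    rw [Finset.sum_comm, ← (t.split (Walker P μ)).symm.sum_comp]
    refine Finset.sum_congr rfl fun x _ => ?_
    simp_rw [ite_and]
    rw [sum_consistent x.1 fun q => if x.2 ∉ lowWeight P μ N ε q then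
      ‖matAct (star (tensorPow U N)) ψ ((t.split _).symm x)‖ ^ 2 else 0]
    refine if_congr ?_ rfl rfl
    obtain ⟨s, i⟩ := x
    have hwt : relWeight (fun j => if s j = 0 then (0 : Fin 2) else 1)
        = ((Finset.univ.filter fun j => s j ≠ 0).card : ℝ) / m := by
      unfold relWeight hammingNorm
      congr 3
      refine Finset.filter_congr fun j _ => ?_
      by_cases h : s j = 0 <;> simp [h]
    simp only [lowWeight, Finset.mem_filter, Finset.mem_univ, true_and, not_le, hwt, bad,
      Sample.split_symm_pos, Sample.split_symm_rest]
    rw [Nat.cast_sub (by omega)]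
  have h2 : ∑ a, g a = ‖ψ‖ ^ 2 := by
    rw [PiLp.norm_sq_eq_of_L2]
    exact sum_norm_sq_matAct (Unitary.star_mem (tensorPow_mem_unitary hU N)) _
  simp_rw [h1]
  rw [Finset.sum_comm, ← h2, Finset.mul_sum]
  refine Finset.sum_le_sum fun a _ => ?_
  rw [← Finset.sum_filter, Finset.sum_const, nsmul_eq_mul]
  refine mul_le_mul_of_nonneg_right ?_ (by positivity)
  refine le_trans (le_of_eq ?_) (card_bad_sample_le hm hmN hε hε1 fun k => a k ≠ 0)
  congr 2
  ext t
  simp only [Finset.mem_filter, bad]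

end Security

/-! ### Probability of failure. -/

section Failure

variable {P μ : ℕ} [NeZero P] {N m : ℕ} {E : Type*} [NormedAddCommGroup E]
  [InnerProductSpace ℂ E] {O : Type} [Fintype O] [DecidableEq O]

omit [Fintype O] in
theorem maxProb_le_one {w : WalkSetting} {U : WalkerOp P μ}
    (hU : U ∈ Matrix.unitaryGroup (Walker P μ) ℂ) (hw : ∀ a, honestState P μ w a = U a 0)
    (out : Walker P μ → O) : maxProb out w ≤ 1 := by
  refine Real.iSup_le (fun o => ?_) zero_le_one
  have h2 : ∑ a, ‖U a 0‖ ^ 2 = 1 := by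
    have := sum_norm_sq_matAct hU (Pi.single 0 (1 : ℂ))
    simpa [matAct, Pi.single_apply, apply_ite norm, ite_pow] using this
  rw [honestProb_eq hw, ← h2]
  exact Finset.sum_le_sum_of_subset_of_nonneg (Finset.filter_subset _ _) fun a _ _ => by positivity

theorem card_walker (P μ : ℕ) [NeZero P] : Fintype.card (Walker P μ) = 2 ^ (μ + 1) * P := by
  rw [Fintype.card_prod, Fintype.card_fun, Fintype.card_fin, Fintype.card_fin, ZMod.card,
    mul_comm]

theorem two_le_dim (P μ : ℕ) [NeZero P] : 2 ≤ 2 ^ (μ + 1) * P := by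
  have h1 : 1 ≤ 2 ^ μ := Nat.one_le_two_pow
  have h2 : 1 ≤ P := Nat.one_le_iff_ne_zero.2 (NeZero.ne P)
  rw [pow_succ]
  nlinarith [Nat.mul_le_mul h1 h2]

/-- The bound on the distance of the final string from an ideal one. -/
theorem distFromIdeal_le_of_length {w : WalkSetting} {U : WalkerOp P μ}
    (hU : U ∈ Matrix.unitaryGroup (Walker P μ) ℂ) (hw : ∀ a, honestState P μ w a = U a 0)
    (hm : 0 < m) (hmN : 2 * m ≤ N) {ε : ℝ} (hε : 0 < ε) (hε1 : ε < 1)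
    (out : Walker P μ → O) (ψ : JointVector P μ N E) (t : Sample N m) (q : Fin m → Fin 2)
    (hp : 0 < testProb w ψ t q) {l : ℕ}
    (hl : l = ⌊stringLength (2 ^ (μ + 1) * P) N m (-Real.logb 2 (maxProb out w)) ε q⌋₊)
    (h : PMF ((Fin (N - m) → O) → Fin l → Fin 2)) (hh : TwoUniversal h) :
    distFromIdeal h (rawBlock out w ψ t q) ≤ ENNReal.ofReal
      (ε + 4 * √((∑ x, ‖realVec U t ψ q x - idealVec U t ψ q (lowWeight P μ N ε q) x‖ ^ 2)
        / testProb w ψ t q)) := by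
  -- An empty string is perfectly ideal. This also disposes of negative lengths, where the floor no
  -- longer lies below the length.
  rcases Nat.eq_zero_or_pos l with h0 | h0
  · subst h0
    rw [distFromIdeal_length_zero]
    exact zero_le
  set G := maxProb out w with hG
  have hG0 : 0 < G := maxProb_pos hU hw out
  have hG1 : G ≤ 1 := maxProb_le_one hU hw out
  have hcast : ((N - m : ℕ) : ℝ) = N - m := Nat.cast_sub (by omega)
  -- The observed weight may be zero, so strict positivity of $\delta$ supplies the positive radius
  -- that `card_hammingBall_le` needs.
  have hδ : 0 < sampleError N m ε := by
    refine Real.sqrt_pos.2 (div_pos (mul_pos (by positivity) (Real.log_pos ?_)) ?_)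
    · rw [lt_div_iff₀ (by positivity)]
      nlinarith
    · exact_mod_cast Nat.mul_pos hm (by omega)
  have hα : 0 < relWeight q + sampleError N m ε :=
    add_pos_of_nonneg_of_pos (div_nonneg (Nat.cast_nonneg _) (Nat.cast_nonneg _)) hδ
  refine distFromIdeal_rawBlock_le hU hw out ψ t q hp (lowWeight P μ N ε q)
    (b := G ^ etaQ N m ε q) (by positivity) hε.le ?_ ?_ h hh
  · intro i hi z
    refine (sum_tensorPow_le (G := G) hU out (fun o => ?_) (N - m) i z).trans ?_
    · rw [← honestProb_eq hw]
      exact honestProb_le_maxProb w out o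
    · rw [← Real.rpow_natCast]
      refine Real.rpow_le_rpow_of_exponent_ge hG0 hG1 ?_
      have hi := (Finset.mem_filter.1 hi).2
      have hsum : ((Finset.univ.filter fun j => i j = 0).card : ℝ)
          + ((Finset.univ.filter fun j => i j ≠ 0).card : ℝ) = N - m := by
        rw [← hcast]
        have := Finset.card_filter_add_card_filter_not (s := (Finset.univ : Finset (Fin (N - m))))
          (fun j => i j = 0)
        rw [Finset.card_univ, Fintype.card_fin] at this
        exact_mod_cast this
      rw [hcast] at hi
      unfold etaQ
      linarith
  · have hlen : (l : ℝ) ≤ stringLength (2 ^ (μ + 1) * P) N m (-Real.logb 2 G) ε q := by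
      rw [hl] at h0 ⊢
      exact Nat.floor_le (Nat.pos_of_floor_pos h0).le
    have hball := card_hammingBall_le (N - m) (card_walker P μ) (two_le_dim P μ) hα
    rw [← two_rpow_stringLength_mul (N := N) (two_le_dim P μ) hG0 hε q]
    refine mul_le_mul ?_ (mul_le_mul_of_nonneg_right ?_ (by positivity)) (by positivity)
      (by positivity)
    · rw [← Real.rpow_natCast]
      exact Real.rpow_le_rpow_of_exponent_le one_le_two hlen
    · rw [← hcast]
      exact hball

theorem failureProb_le {times : Finset ℕ} {c : CoinFamily} {w : WalkSetting}
    (hset : w ∈ settings times c) (hm : 0 < m) (hmN : 2 * m ≤ N) {ε : ℝ} (hε : 0 < ε)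
    (out : Walker P μ → O) (ψ : JointVector P μ N E) (hψ : ‖ψ‖ = 1)
    (hash : ∀ l : ℕ, PMF ((Fin (N - m) → O) → Fin l → Fin 2))
    (hhash : ∀ l, TwoUniversal (hash l)) :
    failureProb out w ψ hash
      (fun q => ⌊stringLength (2 ^ (μ + 1) * P) N m (-Real.logb 2 (maxProb out w)) ε q⌋₊)
      (5 * ε + 2 * ε ^ (1 / 3 : ℝ)) ≤ ε ^ (1 / 3 : ℝ) := by
  obtain ⟨U, hU, hw⟩ := honestState_eq_mulVec (P := P) (μ := μ) hset
  have hch : (0 : ℝ) < N.choose m := by exact_mod_cast Nat.choose_pos (by omega)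
  have hp0 : ∀ (t : Sample N m) (q : Fin m → Fin 2), 0 ≤ testProb w ψ t q := fun t q => by
    rw [testProb_eq hU hw]; positivity
  have hsp0 : ∀ (t : Sample N m) (q : Fin m → Fin 2), 0 ≤ sampleProb w ψ t q := fun t q =>
    mul_nonneg (by positivity) (hp0 t q)
  -- For $\varepsilon\ge1$ the bound $\varepsilon^{1/3}$ already exceeds the total probability.
  rcases le_or_gt 1 ε with h1 | h1
  · calc _ ≤ ∑ t : Sample N m, ∑ q : Fin m → Fin 2, sampleProb w ψ t q := by
          refine Finset.sum_le_sum fun t _ => Finset.sum_le_sum fun q _ => ?_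
          split_ifs
          · exact hsp0 t q
          · exact le_rfl
      _ = 1 := by
          simp_rw [sampleProb, ← Finset.mul_sum, sum_testProb hU hw, hψ]
          rw [Finset.sum_const, Finset.card_univ, Fintype.card_finset_len, Fintype.card_fin,
            nsmul_eq_mul]
          field_simp
      _ ≤ _ := Real.one_le_rpow h1 (by norm_num)
  · set r := ε + ε ^ (1 / 3 : ℝ) / 2 with hr
    have hx0 : 0 < ε ^ (1 / 3 : ℝ) := Real.rpow_pos_of_pos hε _
    have hr0 : 0 < r := by positivity
    calc _ ≤ ∑ t : Sample N m, ∑ q : Fin m → Fin 2, (N.choose m : ℝ)⁻¹ * (r ^ 2)⁻¹ *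
            ∑ x, ‖realVec U t ψ q x - idealVec U t ψ q (lowWeight P μ N ε q) x‖ ^ 2 := by
          refine Finset.sum_le_sum fun t _ => Finset.sum_le_sum fun q _ => ?_
          set e := ∑ x, ‖realVec U t ψ q x - idealVec U t ψ q (lowWeight P μ N ε q) x‖ ^ 2 with he
          have he0 : 0 ≤ e := by positivity
          split_ifs with hgood
          · positivity
          · rw [sampleProb, mul_assoc]
            refine mul_le_mul_of_nonneg_left ?_ (by positivity)
            rcases (hp0 t q).eq_or_lt with hpz | hpp
            · rw [← hpz]; positivity
            -- Markov's inequality termwise: a failing pair must have $e\ge r^2p$, since otherwise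
            -- its distance is at most $\varepsilon+4r$.
            by_contra hcon
            refine hgood ((distFromIdeal_le_of_length hU hw hm hmN hε h1 out ψ t q hpp rfl
              (hash _) (hhash _)).trans (ENNReal.ofReal_le_ofReal ?_))
            rw [not_le, ← div_eq_inv_mul, div_lt_iff₀ (by positivity)] at hcon
            have h2 : √(e / testProb w ψ t q) ≤ r := by
              rw [Real.sqrt_le_left hr0.le, div_le_iff₀ hpp, mul_comm]
              exact hcon.le
            rw [hr] at h2
            linarith
      _ = (N.choose m : ℝ)⁻¹ * (r ^ 2)⁻¹ * ∑ t : Sample N m, ∑ q : Fin m → Fin 2,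
            ∑ x, ‖realVec U t ψ q x - idealVec U t ψ q (lowWeight P μ N ε q) x‖ ^ 2 := by
          simp_rw [Finset.mul_sum]
      _ ≤ (N.choose m : ℝ)⁻¹ * (r ^ 2)⁻¹ * (ε ^ 2 * N.choose m * ‖ψ‖ ^ 2) := by
          gcongr
          exact sum_sum_error_le hm hmN hε h1.le hU ψ
      _ = ε ^ 2 / r ^ 2 := by
          rw [hψ]; field_simp
      _ ≤ _ := ratio_le_rpow hε h1.le

end Failure

end QWRNG

theorem theorem3 {E : Type*} [NormedAddCommGroup E] [InnerProductSpace ℂ E] [CompleteSpace E]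
    (P μ : ℕ) [NeZero P] (times : Finset ℕ) (c : QWRNG.CoinFamily)
    (N m : ℕ) (hm : 0 < m) (hmN : 2 * m ≤ N) (ε : ℝ) (hε : 0 < ε)
    (ψ : QWRNG.JointVector P μ N E) (hψ : ‖ψ‖ = 1) :
    -- position and memory coins are measured
    (∀ w ∈ QWRNG.settings times c,
      QWRNG.maxProb (QWRNG.positionAndMemory (P := P) (μ := μ)) w
        = QWRNG.guessMemory P μ times c →
      ∀ hash : ∀ l : ℕ,
          PMF ((Fin (N - m) → ZMod P × (Fin μ → Fin 2)) → Fin l → Fin 2),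
        (∀ l, QWRNG.TwoUniversal (hash l)) →
        QWRNG.failureProb QWRNG.positionAndMemory w ψ hash
          (fun q : Fin m → Fin 2 => ⌊QWRNG.stringLength (2 ^ (μ + 1) * P) N m
            (-Real.logb 2 (QWRNG.guessMemory P μ times c)) ε q⌋₊)
          (5 * ε + 2 * ε ^ (1 / 3 : ℝ)) ≤ ε ^ (1 / 3 : ℝ)) ∧
    -- only the position is measured
    (∀ w ∈ QWRNG.settings times c,
      QWRNG.maxProb (QWRNG.positionOnly (P := P) (μ := μ)) w
        = QWRNG.guessPosition P μ times c →
      ∀ hash : ∀ l : ℕ, PMF ((Fin (N - m) → ZMod P) → Fin l → Fin 2),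
        (∀ l, QWRNG.TwoUniversal (hash l)) →
        QWRNG.failureProb QWRNG.positionOnly w ψ hash
          (fun q : Fin m → Fin 2 => ⌊QWRNG.stringLength (2 ^ (μ + 1) * P) N m
            (-Real.logb 2 (QWRNG.guessPosition P μ times c)) ε q⌋₊)
          (5 * ε + 2 * ε ^ (1 / 3 : ℝ)) ≤ ε ^ (1 / 3 : ℝ)) := by
  refine ⟨fun w hw hmax hash hhash => ?_, fun w hw hmax hash hhash => ?_⟩
  -- Security holds for every setting with its own maximum probability; optimality only identifies
  -- that number with the minimum over the family.
  · rw [← hmax]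
    exact QWRNG.failureProb_le hw hm hmN hε _ ψ hψ hash hhash
  · rw [← hmax]
    exact QWRNG.failureProb_le hw hm hmN hε _ ψ hψ hash hhash
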